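/- Logarithms are to base 2 and $H_b(p)=-p\log p-(1-p)\log(1-p)$. In the binary i.i.d. deletion channel with deletion probability $p_d\in[0,1]$, each transmitted bit is deleted independently with probability $p_d$; the remaining bits are received in order, and neither side knows the positions of the deletions. Its capacity, in bits per channel use, is $$C_d=C_d(p_d)=\lim_{N\to\infty}\frac1N\max_{P(\mathbf X)}I(\mathbf X;\mathbf Y),$$ where $\mathbf X$ ranges over random inputs in $\{0,1\}^N$ and $\mathbf Y$ is the received sequence; this limit exists. For $1\le j\le n$ let $$W_j(n)=\frac{1}{\binom nj}\sum_{l=1}^{n-1}2^{-l-1}(n-l+3)\sum_{j'=1}^{j}\binom{l}{j'}\binom{n-l}{j-j'}\log\binom{l}{j'}+2^{-n+1}\log\binom nj$$ (terms with $\binom{l}{j'}=0$ are zero), and $$L_n(p_d)=1-p_d-H_b(p_d)+\frac1n\sum_{j=1}^{n}W_j(n)\binom nj p_d^{\,j}(1-p_d)^{n-j}.$$ 1. (Lower bound.) $C_d(p_d)\ge L_n(p_d)$ for every $n\ge1$ and every $p_d\in[0,1]$. 2. (Improvement on Gallager's bound $1-H_b(p_d)$.) For every $n\ge7$ there is a threshold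 $t_n\in(0,1)$ such that, for $0<p_d\le1$, one has $L_n(p_d)>1-H_b(p_d)$ if and only if $p_d<t_n$. Moreover $t_n>1/10$ for every $n\ge11$. 3. (First-order term for small $p_d$.) For every fixed $n\ge1$, as $p_d\to0^+$, $$L_n(p_d)=1+p_d\log p_d-\bigl(\log(2e)-W_1(n)\bigr)p_d+O(p_d^2).$$ The series in $A_1=\log(2e)-\sum_{l=1}^{\infty}2^{-l-1}l\log l$ converges, and $\log(2e)-W_1(n)\to A_1$ as $n\to\infty$. Consequently, for every $\varepsilon>0$ and all sufficiently small $p_d>0$, $$C_d(p_d)\ge1+p_d\log p_d-(A_1+\varepsilon)p_d .$$ -/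

import Mathlib

open Filter Topology Asymptotics

noncomputable section

namespace DeletionChannel

/-- The sequence that is received when the input `x` of length `N` is sent and exactly the bits at
the positions in `D` are deleted: the remaining bits, in their original order. -/
def received {N : ℕ} (x : Fin N → Bool) (D : Finset (Fin N)) : List Bool :=
  ((List.finRange N).filter (fun i => i ∉ D)).map x

/-- The finite set of all sequences that can be received when `N` bits are sent. -/
def outputs (N : ℕ) : Finset (List Bool) :=
  Finset.univ.image (fun a : (Fin N → Bool) × Finset (Fin N) => received a.1 a.2)

/-- The probability `P(y | x)` that `y` is received when `x` is sent and every bit is deleted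
independently with probability `p`. -/
def transitionProb {N : ℕ} (p : ℝ) (x : Fin N → Bool) (y : List Bool) : ℝ :=
  ∑ D : Finset (Fin N), if received x D = y then p ^ D.card * (1 - p) ^ (N - D.card) else 0

/-- The probability of receiving `y` when the input has distribution `P`. -/
def outputProb {N : ℕ} (p : ℝ) (P : (Fin N → Bool) → ℝ) (y : List Bool) : ℝ :=
  ∑ x, P x * transitionProb p x y

/-- Shannon entropy in bits of a distribution `q` supported on the finite set `S`. -/
def entropy {β : Type*} (S : Finset β) (q : β → ℝ) : ℝ :=
  -∑ y ∈ S, q y * Real.logb 2 (q y)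

/-- The mutual information `I(X; Y) = H(Y) - H(Y | X)` in bits, where `X` is a random input of
length `N` with distribution `P` and `Y` is the sequence received over the deletion channel. -/
def mutualInfo (N : ℕ) (p : ℝ) (P : (Fin N → Bool) → ℝ) : ℝ :=
  entropy (outputs N) (outputProb p P) - ∑ x, P x * entropy (outputs N) (transitionProb p x)

/-- The maximum of `I(X; Y)` over all distributions of the input `X` of length `N`. -/
def maxInfo (N : ℕ) (p : ℝ) : ℝ :=
  sSup (mutualInfo N p '' stdSimplex ℝ (Fin N → Bool))

theorem isGreatest_maxInfo (N : ℕ) (p : ℝ) :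
    IsGreatest (mutualInfo N p '' stdSimplex ℝ (Fin N → Bool)) (maxInfo N p) := by
  have hc : Continuous (mutualInfo N p) := by
    have h1 : Continuous (fun t : ℝ => t * Real.logb 2 t) := by
      have : (fun t : ℝ => t * Real.logb 2 t) = fun t => t * Real.log t / Real.log 2 := by
        funext t; simp only [Real.logb]; ring
      rw [this]
      exact Real.continuous_mul_log.div_const _
    unfold mutualInfo entropy
    refine Continuous.sub (Continuous.neg (continuous_finsetSum _ fun y _ => h1.comp ?_)) ?_
    · unfold outputProb; fun_prop
    · fun_prop
  refine ((isCompact_stdSimplex ℝ _).image hc).isGreatest_sSup (Set.Nonempty.image _ ?_)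
  exact ⟨_, single_mem_stdSimplex ℝ (fun _ => false)⟩

/-- The capacity of the deletion channel with deletion probability `p`, in bits per channel use:
the limit of the maximal mutual information per input bit. -/
def capacity (p : ℝ) : ℝ :=
  limUnder atTop (fun N : ℕ => maxInfo N p / N)

/-- The binary entropy function, in bits. -/
def Hb (p : ℝ) : ℝ :=
  -p * Real.logb 2 p - (1 - p) * Real.logb 2 (1 - p)

/-- The coefficients `W_j(n)`. -/
def W (j n : ℕ) : ℝ :=
  1 / (n.choose j : ℝ) *
      ∑ l ∈ Finset.Icc 1 (n - 1), (2 : ℝ) ^ (-(l : ℤ) - 1) * ((n : ℝ) - l + 3) *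
        ∑ i ∈ Finset.Icc 1 j,
          (l.choose i : ℝ) * ((n - l).choose (j - i) : ℝ) * Real.logb 2 (l.choose i : ℝ)
    + (2 : ℝ) ^ (-(n : ℤ) + 1) * Real.logb 2 (n.choose j : ℝ)

/-- The lower bound for block length `n` and deletion probability `p`. -/
def lowerBound (n : ℕ) (p : ℝ) : ℝ :=
  1 - p - Hb p +
    1 / (n : ℝ) * ∑ j ∈ Finset.Icc 1 n, W j n * (n.choose j : ℝ) * p ^ j * (1 - p) ^ (n - j)

/-- `A₁ = log₂(2e) - ∑_{l ≥ 1} 2^{-l-1} l log₂ l` (the term of the series for `l = 0` is zero). -/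
def A₁ : ℝ :=
  Real.logb 2 (2 * Real.exp 1) - ∑' l : ℕ, (2 : ℝ) ^ (-(l : ℤ) - 1) * l * Real.logb 2 l

end DeletionChannel

end

namespace DeletionChannel

/-! If an input is cut into pieces, the output is the concatenation of the independent outputs of
the pieces. Seeing these separately can only help, so conditional entropy and mutual information are
subadditive under concatenation (`condEnt_append_le`, `info_append_le`). Fekete's lemma then gives
the limit defining the capacity.

The lower bound comes from uniform inputs. Given its length, the output is again uniform, so its
entropy is at least its mean length `N (1 - p)` (`le_maxInfo`). The conditional entropy is bounded
above by cutting the input into blocks of length `n` and each block into its runs. In a run of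
length `l` only the number `J` of deletions is visible, so its output has entropy `l * Hb p - E log
C(l, J)` (`condEnt_replicate`). A uniform block contains on average `2^(-l-1) (n-l+3)` runs of
length `l < n`: `n-l-1` interior positions of weight `2^(-l-1)` and two end positions of twice that
weight. It is a single run with probability `2^(1-n)`. Averaging over runs gives `runMean`, and
sorting by the total number of deletions in the block gives the `W j n` (`sum_W`).

The scaled gain over `1 - Hb p` is `excess n`. It is concave in `p` because binomial coefficients
are log-concave, it vanishes at `0` and is negative at `1`; a positive slope at `0` therefore forces
exactly one sign change. The slope for `n ≥ 7`, and the value at `1/10` for `n ≥ 11`, are bounded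
with rational estimates of logarithms. For small `p` everything is linearized at `0`, and letting
`n` grow turns `W 1 n` into the series in `A₁`. -/

/-! ### The channel law as a recursion on the input list -/

/-- The expectation of `f Y`, where `Y` is received when `x` is sent. -/
def expect (p : ℝ) : List Bool → (List Bool → ℝ) → ℝ
  | [], f => f []
  | b :: x, f => p * expect p x f + (1 - p) * expect p x (fun y => f (b :: y))

/-- The probability that `y` is received when `x` is sent. -/
noncomputable def prob (p : ℝ) (x y : List Bool) : ℝ :=
  expect p x (fun z => if z = y then 1 else 0)

theorem sum_finset_fin_succ {N : ℕ} (F : Finset (Fin (N + 1)) → ℝ) :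
    ∑ D, F D = ∑ D : Finset (Fin N), F (D.map (Fin.succEmb N)) +
      ∑ D : Finset (Fin N), F (insert 0 (D.map (Fin.succEmb N))) := by
  have h0 : (0 : Fin (N + 1)) ∉ Finset.univ.map (Fin.succEmb N) := by simp
  have h1 : (Finset.univ : Finset (Fin (N + 1))) =
      insert 0 (Finset.univ.map (Fin.succEmb N)) := by
    ext i; refine Fin.cases ?_ ?_ i <;> simp
  have h2 : (Finset.univ.map (Fin.succEmb N)).powerset =
      (Finset.univ : Finset (Finset (Fin N))).map (Finset.mapEmbedding (Fin.succEmb N)).toEmbedding := by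
    ext D
    simp only [Finset.mem_powerset, Finset.mem_map, Finset.mem_univ, true_and]
    constructor
    · intro h
      obtain ⟨u, -, rfl⟩ := Finset.subset_map_iff.1 h
      exact ⟨u, rfl⟩
    · rintro ⟨u, rfl⟩
      exact Finset.map_subset_map.2 (Finset.subset_univ u)
  rw [← Finset.powerset_univ, h1, Finset.sum_powerset_insert h0, h2, Finset.sum_map, Finset.sum_map]
  rfl

theorem received_map_succ {N : ℕ} (x : Fin (N + 1) → Bool) (D : Finset (Fin N)) :
    received x (D.map (Fin.succEmb N)) = x 0 :: received (fun i => x i.succ) D := by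
  simp [received, List.finRange_succ, List.filter_map, Function.comp_def]

theorem received_insert_zero {N : ℕ} (x : Fin (N + 1) → Bool) (D : Finset (Fin N)) :
    received x (insert 0 (D.map (Fin.succEmb N))) = received (fun i => x i.succ) D := by
  simp [received, List.finRange_succ, List.filter_map, Function.comp_def, Fin.succ_ne_zero]

/-- Links the sum over deletion patterns to the recursion: condition on whether the first bit is
deleted. -/
theorem sum_pattern {N : ℕ} (p : ℝ) (x : Fin N → Bool) (f : List Bool → ℝ) :
    ∑ D : Finset (Fin N), p ^ D.card * (1 - p) ^ (N - D.card) * f (received x D) =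
      expect p (List.ofFn x) f := by
  induction N generalizing f with
  | zero =>
    have : (default : Finset (Fin 0)) = ∅ := rfl
    simp [expect, received, this]
  | succ N ih =>
    rw [sum_finset_fin_succ, List.ofFn_succ, expect, ← ih, ← ih, add_comm, Finset.mul_sum,
      Finset.mul_sum]
    congr 1 <;> refine Finset.sum_congr rfl fun D _ => ?_
    · rw [received_insert_zero, Finset.card_insert_of_notMem (by simp), Finset.card_map,
        Nat.add_sub_add_right]
      ring
    · have : D.card ≤ N := by simpa using D.card_le_univ
      rw [received_map_succ, Finset.card_map, Nat.succ_sub this, pow_succ]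
      ring

section expectation

variable {p : ℝ}

theorem expect_add (x : List Bool) (f g : List Bool → ℝ) :
    expect p x (fun y => f y + g y) = expect p x f + expect p x g := by
  induction x generalizing f g with
  | nil => rfl
  | cons b x ih => simp only [expect, ih]; ring

theorem expect_const_mul (x : List Bool) (c : ℝ) (f : List Bool → ℝ) :
    expect p x (fun y => c * f y) = c * expect p x f := by
  induction x generalizing f with
  | nil => rfl
  | cons b x ih => simp only [expect, ih]; ring

theorem expect_neg (x : List Bool) (f : List Bool → ℝ) :
    expect p x (fun y => -f y) = -expect p x f := by
  simpa using expect_const_mul (p := p) x (-1) f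

theorem expect_sub (x : List Bool) (f g : List Bool → ℝ) :
    expect p x (fun y => f y - g y) = expect p x f - expect p x g := by
  simp only [sub_eq_add_neg, expect_add, expect_neg]

theorem expect_const (x : List Bool) (c : ℝ) : expect p x (fun _ => c) = c := by
  induction x with
  | nil => rfl
  | cons b x ih => simp only [expect, ih]; ring

theorem expect_sum {ι : Type*} (s : Finset ι) (x : List Bool) (f : ι → List Bool → ℝ) :
    expect p x (fun y => ∑ i ∈ s, f i y) = ∑ i ∈ s, expect p x (f i) := by
  classical
  induction s using Finset.induction_on with
  | empty => simp [expect_const]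
  | insert a s ha ih => simp only [Finset.sum_insert ha, expect_add, ih]

theorem expect_append (x z : List Bool) (f : List Bool → ℝ) :
    expect p (x ++ z) f = expect p x (fun y => expect p z (fun w => f (y ++ w))) := by
  induction x generalizing f with
  | nil => rfl
  | cons b x ih => simp only [List.cons_append, expect, ih]

theorem expect_congr {x : List Bool} {f g : List Bool → ℝ}
    (h : ∀ y, y.Sublist x → f y = g y) : expect p x f = expect p x g := by
  induction x generalizing f g with
  | nil => exact h [] (List.Sublist.refl _)
  | cons b x ih =>
    rw [expect, expect, ih fun y hy => h y (hy.cons b),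
      ih (f := fun y => f (b :: y)) fun y hy => h _ (hy.cons_cons b)]

theorem expect_eq_sum {x : List Bool} {S : Finset (List Bool)} (hS : ∀ y, y.Sublist x → y ∈ S)
    (f : List Bool → ℝ) : expect p x f = ∑ y ∈ S, prob p x y * f y := by
  have : expect p x f = expect p x (fun z => ∑ y ∈ S, f y * (if z = y then 1 else 0)) :=
    expect_congr fun y hy => by simp [hS y hy]
  rw [this, expect_sum]
  exact Finset.sum_congr rfl fun y _ => by rw [expect_const_mul, prob, mul_comm]

theorem expect_eq_sum_sublists (x : List Bool) (f : List Bool → ℝ) :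
    expect p x f = ∑ y ∈ x.sublists.toFinset, prob p x y * f y :=
  expect_eq_sum (by simp) f

theorem prob_append_eq_expect (x z y : List Bool) :
    prob p (x ++ z) y = expect p x (fun a => expect p z (fun b => if a ++ b = y then 1 else 0)) :=
  expect_append _ _ _

theorem prob_nil (y : List Bool) : prob p [] y = if y = [] then 1 else 0 := by
  simp [prob, expect, eq_comm]

theorem prob_cons_nil (b : Bool) (x : List Bool) : prob p (b :: x) [] = p * prob p x [] := by
  simp [prob, expect, expect_const]

theorem prob_cons_cons (b c : Bool) (x y : List Bool) :
    prob p (b :: x) (c :: y) = p * prob p x (c :: y) + (1 - p) * if b = c then prob p x y else 0 := by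
  by_cases h : b = c <;> simp [prob, expect, h, expect_const]

variable (hp : p ∈ Set.Icc (0 : ℝ) 1)
include hp

theorem expect_mono {f g : List Bool → ℝ} (h : ∀ y, f y ≤ g y) (x : List Bool) :
    expect p x f ≤ expect p x g := by
  induction x generalizing f g with
  | nil => exact h _
  | cons b x ih =>
    have h1 := ih h
    have h2 := ih (f := fun y => f (b :: y)) (g := fun y => g (b :: y)) fun y => h _
    have := hp.1
    have : 0 ≤ 1 - p := sub_nonneg.2 hp.2
    simp only [expect]
    gcongr

theorem prob_nonneg (x y : List Bool) : 0 ≤ prob p x y := by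
  rw [← expect_const (p := p) x 0]
  exact expect_mono hp (fun z => by split_ifs <;> simp) x

/-- Logarithms of probabilities need comparing only at outputs that actually occur, which keeps the
junk value of `Real.logb` at `0` out of the estimates. -/
theorem expect_mono_of_prob_pos {x : List Bool} {f g : List Bool → ℝ}
    (h : ∀ y, 0 < prob p x y → f y ≤ g y) : expect p x f ≤ expect p x g := by
  rw [expect_eq_sum_sublists, expect_eq_sum_sublists]
  refine Finset.sum_le_sum fun y _ => ?_
  rcases (prob_nonneg hp x y).eq_or_lt with h0 | h0
  · simp [← h0]
  · exact mul_le_mul_of_nonneg_left (h y h0) h0.le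

/-- Turning `x` into `y` and `z` into `w` is only one of the ways to turn `x ++ z` into `y ++ w`. -/
theorem prob_mul_prob_le (x z y w : List Bool) :
    prob p x y * prob p z w ≤ prob p (x ++ z) (y ++ w) := by
  rw [prob_append_eq_expect, mul_comm, prob, prob, ← expect_const_mul]
  refine expect_mono hp (fun a => ?_) x
  rw [mul_comm, ← expect_const_mul]
  refine expect_mono hp (fun b => ?_) z
  by_cases h1 : a = y <;> by_cases h2 : b = w <;> simp [h1, h2]; split_ifs <;> norm_num

end expectation

/-! ### Subadditivity of entropy and information under concatenation -/

/-- The entropy in bits of the sequence received when `x` is sent. -/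
noncomputable def condEnt (p : ℝ) (x : List Bool) : ℝ :=
  -expect p x (fun y => Real.logb 2 (prob p x y))

theorem condEnt_append_le {p : ℝ} (hp : p ∈ Set.Icc (0 : ℝ) 1) (x z : List Bool) :
    condEnt p (x ++ z) ≤ condEnt p x + condEnt p z := by
  rw [condEnt, condEnt, condEnt, expect_append, ← neg_add, neg_le_neg_iff,
    ← expect_const (p := p) x (expect p z _), ← expect_add]
  refine expect_mono_of_prob_pos hp fun y hy => ?_
  rw [← expect_const (p := p) z (Real.logb 2 (prob p x y)), ← expect_add]
  refine expect_mono_of_prob_pos hp fun w hw => ?_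
  rw [← Real.logb_mul hy.ne' hw.ne']
  exact Real.logb_le_logb_of_le (by norm_num) (mul_pos hy hw) (prob_mul_prob_le hp x z y w)

/-- The mutual information between input and output, when the input is `x i` with
probability `w i`. -/
noncomputable def info {ι : Type*} [Fintype ι] (p : ℝ) (w : ι → ℝ) (x : ι → List Bool) : ℝ :=
  ∑ i, w i * expect p (x i) (fun y =>
    Real.logb 2 (prob p (x i) y) - Real.logb 2 (∑ j, w j * prob p (x j) y))

/-- This is `log t ≤ t - 1` at `t = v q₁ q₂ / (q v₁ v₂)`, weighted by `a v₁ v₂`. The comparison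
hypotheses make the denominators and logarithms legitimate whenever that weight is positive. -/
theorem info_term_le {a v v₁ v₂ q q₁ q₂ : ℝ} (ha : 0 ≤ a) (hv₁ : 0 ≤ v₁) (hv₂ : 0 ≤ v₂)
    (hv : v₁ * v₂ ≤ v) (hq : a * v ≤ q) (hq₁ : a * v₁ ≤ q₁) (hq₂ : a * v₂ ≤ q₂) :
    a * (v₁ * (v₂ * ((Real.logb 2 v - Real.logb 2 q) - (Real.logb 2 v₁ - Real.logb 2 q₁) -
      (Real.logb 2 v₂ - Real.logb 2 q₂)))) ≤
      (a * v * (q₁ * q₂ / q) - a * (v₁ * v₂)) / Real.log 2 := by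
  have hl : 0 < Real.log 2 := Real.log_pos (by norm_num)
  have hv0 : 0 ≤ v := (mul_nonneg hv₁ hv₂).trans hv
  have hq0 : 0 ≤ q := (mul_nonneg ha hv0).trans hq
  have hq10 : 0 ≤ q₁ := (mul_nonneg ha hv₁).trans hq₁
  have hq20 : 0 ≤ q₂ := (mul_nonneg ha hv₂).trans hq₂
  have hz : a * (v₁ * v₂) = 0 → a * (v₁ * (v₂ * ((Real.logb 2 v - Real.logb 2 q) -
      (Real.logb 2 v₁ - Real.logb 2 q₁) - (Real.logb 2 v₂ - Real.logb 2 q₂)))) ≤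
      (a * v * (q₁ * q₂ / q) - a * (v₁ * v₂)) / Real.log 2 := by
    intro h
    rw [← mul_assoc v₁, ← mul_assoc a, h, zero_mul, sub_zero]
    positivity
  rcases ha.eq_or_lt with h | ha'
  · exact hz (by simp [← h])
  rcases hv₁.eq_or_lt with h | hv₁'
  · exact hz (by simp [← h])
  rcases hv₂.eq_or_lt with h | hv₂'
  · exact hz (by simp [← h])
  have hv' : 0 < v := (mul_pos hv₁' hv₂').trans_le hv
  have hq' : 0 < q := (mul_pos ha' hv').trans_le hq
  have hq1' : 0 < q₁ := (mul_pos ha' hv₁').trans_le hq₁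
  have hq2' : 0 < q₂ := (mul_pos ha' hv₂').trans_le hq₂
  have h1 := Real.log_le_sub_one_of_pos (x := v * (q₁ * q₂ / q) / (v₁ * v₂)) (by positivity)
  rw [Real.log_div (by positivity) (by positivity), Real.log_mul (by positivity) (by positivity),
    Real.log_div (by positivity) (by positivity), Real.log_mul (by positivity) (by positivity),
    Real.log_mul (by positivity) (by positivity)] at h1
  have h2 : a * (v₁ * (v₂ * ((Real.logb 2 v - Real.logb 2 q) - (Real.logb 2 v₁ - Real.logb 2 q₁) -
      (Real.logb 2 v₂ - Real.logb 2 q₂)))) = a * (v₁ * v₂) * (Real.log v + (Real.log q₁ +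
        Real.log q₂ - Real.log q) - (Real.log v₁ + Real.log v₂)) / Real.log 2 := by
    simp only [Real.logb]; field_simp; ring
  rw [h2]
  gcongr
  calc _ ≤ a * (v₁ * v₂) * (v * (q₁ * q₂ / q) / (v₁ * v₂) - 1) := by gcongr
    _ = _ := by field_simp

/-- A data-processing inequality for possibly dependent pieces `u i`, `v i`. Termwise `log t ≤ t -
1` reduces the difference to (total mass of `Q₁ ⊗ Q₂`) minus one, which is zero. -/
theorem info_append_le {ι : Type*} [Fintype ι] {p : ℝ} (hp : p ∈ Set.Icc (0 : ℝ) 1)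
    {w : ι → ℝ} (hw : ∀ i, 0 ≤ w i) (hw1 : ∑ i, w i = 1) (u v : ι → List Bool) :
    info p w (fun i => u i ++ v i) ≤ info p w u + info p w v := by
  classical
  set S := Finset.univ.biUnion fun i => (u i).sublists.toFinset with hS
  set T := Finset.univ.biUnion fun i => (v i).sublists.toFinset with hT
  have hS' : ∀ i y, y.Sublist (u i) → y ∈ S := fun i y h =>
    Finset.mem_biUnion.2 ⟨i, Finset.mem_univ _, by simpa using h⟩
  have hT' : ∀ i y, y.Sublist (v i) → y ∈ T := fun i y h =>
    Finset.mem_biUnion.2 ⟨i, Finset.mem_univ _, by simpa using h⟩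
  set Q : List Bool → ℝ := fun y => ∑ j, w j * prob p (u j ++ v j) y with hQ
  set Q₁ : List Bool → ℝ := fun y => ∑ j, w j * prob p (u j) y with hQ₁
  set Q₂ : List Bool → ℝ := fun y => ∑ j, w j * prob p (v j) y with hQ₂
  have hle : ∀ (x : ι → List Bool) i y, w i * prob p (x i) y ≤ ∑ j, w j * prob p (x j) y :=
    fun x i y => Finset.single_le_sum (f := fun j => w j * prob p (x j) y)
      (fun j _ => mul_nonneg (hw j) (prob_nonneg hp _ _)) (Finset.mem_univ i)
  have hQ0 : ∀ (x : ι → List Bool) y, 0 ≤ ∑ j, w j * prob p (x j) y := fun x y =>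
    Finset.sum_nonneg fun j _ => mul_nonneg (hw j) (prob_nonneg hp _ _)
  have hsum : ∀ (x : ι → List Bool) (R : Finset (List Bool)),
      (∀ i y, y.Sublist (x i) → y ∈ R) → ∑ y ∈ R, ∑ j, w j * prob p (x j) y = 1 := by
    intro x R hR
    rw [Finset.sum_comm, ← hw1]
    refine Finset.sum_congr rfl fun i _ => ?_
    rw [← Finset.mul_sum]
    have := expect_eq_sum (p := p) (hR i) (fun _ => 1)
    simp only [expect_const, mul_one] at this
    rw [← this, mul_one]
  rw [← sub_nonpos]
  have key : info p w (fun i => u i ++ v i) - (info p w u + info p w v) =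
      ∑ i, ∑ y ∈ S, ∑ z ∈ T, w i * (prob p (u i) y * (prob p (v i) z *
        ((Real.logb 2 (prob p (u i ++ v i) (y ++ z)) - Real.logb 2 (Q (y ++ z))) -
        (Real.logb 2 (prob p (u i) y) - Real.logb 2 (Q₁ y)) -
        (Real.logb 2 (prob p (v i) z) - Real.logb 2 (Q₂ z))))) := by
    rw [info, info, info, ← Finset.sum_add_distrib, ← Finset.sum_sub_distrib]
    refine Finset.sum_congr rfl fun i _ => ?_
    rw [← mul_add, ← mul_sub, expect_append,
      ← expect_const (p := p) (u i) (expect p (v i) _), ← expect_add, ← expect_sub,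
      expect_eq_sum (hS' i), Finset.mul_sum]
    refine Finset.sum_congr rfl fun y _ => ?_
    rw [← expect_const (p := p) (v i) (Real.logb 2 (prob p (u i) y) - _), ← expect_add,
      ← expect_sub, expect_eq_sum (hT' i), Finset.mul_sum, Finset.mul_sum]
    refine Finset.sum_congr rfl fun z _ => ?_
    simp only [hQ, hQ₂, expect_const]
    ring
  rw [key]
  calc _ ≤ ∑ i, ∑ y ∈ S, ∑ z ∈ T, (w i * prob p (u i ++ v i) (y ++ z) *
        (Q₁ y * Q₂ z / Q (y ++ z)) - w i * (prob p (u i) y * prob p (v i) z)) / Real.log 2 :=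
        Finset.sum_le_sum fun i _ => Finset.sum_le_sum fun y _ => Finset.sum_le_sum fun z _ =>
          info_term_le (hw i) (prob_nonneg hp _ _) (prob_nonneg hp _ _)
            (prob_mul_prob_le hp _ _ _ _) (hle (fun i => u i ++ v i) i _) (hle u i y) (hle v i z)
    _ = (∑ y ∈ S, ∑ z ∈ T, Q (y ++ z) * (Q₁ y * Q₂ z / Q (y ++ z)) - 1) / Real.log 2 := by
        simp only [← Finset.sum_div, Finset.sum_sub_distrib]
        congr 2
        · rw [Finset.sum_comm]
          refine Finset.sum_congr rfl fun y _ => ?_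
          rw [Finset.sum_comm]
          refine Finset.sum_congr rfl fun z _ => ?_
          rw [← Finset.sum_mul]
        · rw [← hw1]
          refine Finset.sum_congr rfl fun i _ => ?_
          have h1 := expect_eq_sum (p := p) (hS' i) (fun _ => 1)
          have h2 := expect_eq_sum (p := p) (hT' i) (fun _ => 1)
          simp only [expect_const, mul_one] at h1 h2
          simp only [← Finset.mul_sum, ← h2, mul_one, ← h1]
    _ ≤ (∑ y ∈ S, ∑ z ∈ T, Q₁ y * Q₂ z - 1) / Real.log 2 := by
        have hl : 0 < Real.log 2 := Real.log_pos (by norm_num)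
        refine div_le_div_of_nonneg_right (sub_le_sub_right (Finset.sum_le_sum fun y _ =>
          Finset.sum_le_sum fun z _ => ?_) 1) hl.le
        have h1 : 0 ≤ Q₁ y * Q₂ z := mul_nonneg (hQ0 u y) (hQ0 v z)
        -- If `Q` vanishes, division by zero makes the left side `0`; otherwise `Q` cancels.
        by_cases h : Q (y ++ z) = 0
        · simp [h, h1]
        · rw [mul_div_cancel₀ _ h]
    _ = 0 := by
        rw [← Finset.sum_mul_sum, hsum u S hS', hsum v T hT']
        simp
    _ ≤ 0 := le_rfl

/-! ### Return to the given definitions; existence of the capacity limit -/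

theorem transitionProb_eq_prob {N : ℕ} (p : ℝ) (x : Fin N → Bool) (y : List Bool) :
    transitionProb p x y = prob p (List.ofFn x) y := by
  rw [transitionProb, prob, ← sum_pattern]
  exact Finset.sum_congr rfl fun D _ => by split_ifs <;> simp

theorem sum_outputs_prob_mul {N : ℕ} (p : ℝ) (x : Fin N → Bool) (f : List Bool → ℝ) :
    ∑ y ∈ outputs N, prob p (List.ofFn x) y * f y = expect p (List.ofFn x) f := by
  simp only [← transitionProb_eq_prob, transitionProb, Finset.sum_mul]
  rw [Finset.sum_comm, ← sum_pattern]
  refine Finset.sum_congr rfl fun D _ => ?_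
  have : received x D ∈ outputs N :=
    Finset.mem_image.2 ⟨(x, D), Finset.mem_univ _, rfl⟩
  simp [ite_mul, this]

theorem mutualInfo_eq_info (N : ℕ) (p : ℝ) (P : (Fin N → Bool) → ℝ) :
    mutualInfo N p P = info p P List.ofFn := by
  have h : ∀ y, outputProb p P y = ∑ x, P x * prob p (List.ofFn x) y := fun y => by
    simp only [outputProb, transitionProb_eq_prob]
  simp only [mutualInfo, entropy, info, expect_sub, mul_sub, Finset.sum_sub_distrib, h,
    transitionProb_eq_prob, sum_outputs_prob_mul, mul_neg, Finset.sum_neg_distrib, sub_neg_eq_add]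
  rw [neg_add_eq_sub]
  congr 1
  simp only [Finset.sum_mul]
  rw [Finset.sum_comm]
  refine Finset.sum_congr rfl fun x _ => ?_
  rw [← sum_outputs_prob_mul, Finset.mul_sum]
  exact Finset.sum_congr rfl fun y _ => mul_assoc _ _ _

theorem info_comp_fst {α β : Type*} [Fintype α] [Fintype β] (p : ℝ) (w : α × β → ℝ)
    (u : α → List Bool) :
    info p w (fun i => u i.1) = info p (fun a => ∑ b, w (a, b)) u := by
  simp only [info, Fintype.sum_prod_type, Finset.sum_mul]

theorem info_comp_snd {α β : Type*} [Fintype α] [Fintype β] (p : ℝ) (w : α × β → ℝ)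
    (v : β → List Bool) :
    info p w (fun i => v i.2) = info p (fun b => ∑ a, w (a, b)) v := by
  simp only [info, Fintype.sum_prod_type_right, Finset.sum_mul]

theorem info_comp_equiv {ι κ : Type*} [Fintype ι] [Fintype κ] (p : ℝ) (e : ι ≃ κ) (w : κ → ℝ)
    (x : κ → List Bool) : info p (fun i => w (e i)) (fun i => x (e i)) = info p w x := by
  have h : ∀ y, ∑ j, w (e j) * prob p (x (e j)) y = ∑ j, w j * prob p (x j) y := fun y =>
    e.sum_comp (fun j => w j * prob p (x j) y)
  simp only [info, h]
  exact e.sum_comp (fun i => w i * expect p (x i) (fun y =>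
    Real.logb 2 (prob p (x i) y) - Real.logb 2 (∑ j, w j * prob p (x j) y)))

theorem mutualInfo_le_maxInfo {N : ℕ} {p : ℝ} {P : (Fin N → Bool) → ℝ}
    (hP : P ∈ stdSimplex ℝ (Fin N → Bool)) : mutualInfo N p P ≤ maxInfo N p :=
  (isGreatest_maxInfo N p).2 ⟨P, hP, rfl⟩

theorem ofFn_appendEquiv {M N : ℕ} (i : (Fin M → Bool) × (Fin N → Bool)) :
    List.ofFn (Fin.appendEquiv M N i) = List.ofFn i.1 ++ List.ofFn i.2 := by
  simp [Fin.appendEquiv, List.ofFn_fin_append]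

/-- Split an optimal input for length `M + N` at position `M`; its two marginals are admissible
inputs for the shorter lengths. -/
theorem maxInfo_add_le {p : ℝ} (hp : p ∈ Set.Icc (0 : ℝ) 1) (M N : ℕ) :
    maxInfo (M + N) p ≤ maxInfo M p + maxInfo N p := by
  obtain ⟨P, hP, hPmax⟩ := (isGreatest_maxInfo (M + N) p).1
  set e := Fin.appendEquiv (α := Bool) M N
  have hw1 : ∑ i, P (e i) = 1 := (e.sum_comp P).trans hP.2
  rw [← hPmax, mutualInfo_eq_info, ← info_comp_equiv p e]
  simp only [e, ofFn_appendEquiv]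
  refine (info_append_le hp (fun i => hP.1 _) hw1 _ _).trans (add_le_add ?_ ?_)
  · rw [info_comp_fst p (fun i => P (e i)), ← mutualInfo_eq_info]
    exact mutualInfo_le_maxInfo ⟨fun a => Finset.sum_nonneg fun b _ => hP.1 _, by
      rw [← hw1, Fintype.sum_prod_type]⟩
  · rw [info_comp_snd p (fun i => P (e i)), ← mutualInfo_eq_info]
    exact mutualInfo_le_maxInfo ⟨fun a => Finset.sum_nonneg fun b _ => hP.1 _, by
      rw [← hw1, Fintype.sum_prod_type_right]⟩

/-- A deterministic input carries zero information. This supplies the lower bound required by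
Fekete's lemma. -/
theorem maxInfo_nonneg (N : ℕ) (p : ℝ) : 0 ≤ maxInfo N p := by
  classical
  refine le_trans (le_of_eq ?_)
    (mutualInfo_le_maxInfo (single_mem_stdSimplex ℝ (fun _ : Fin N => false)))
  rw [mutualInfo_eq_info, info, eq_comm]
  refine Finset.sum_eq_zero fun x _ => ?_
  by_cases hx : x = fun _ => false
  · subst hx
    simp [Pi.single_apply, expect_const]
  · simp [Pi.single_apply, hx]

theorem tendsto_maxInfo_div {p : ℝ} (hp : p ∈ Set.Icc (0 : ℝ) 1) :
    Tendsto (fun N : ℕ => maxInfo N p / N) atTop (𝓝 (capacity p)) := by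
  have h : Subadditive (fun N => maxInfo N p) := maxInfo_add_le hp
  refine tendsto_nhds_limUnder ⟨_, h.tendsto_lim ⟨0, ?_⟩⟩
  rintro _ ⟨N, rfl⟩
  exact div_nonneg (maxInfo_nonneg N p) N.cast_nonneg

/-! ### Uniform inputs and division into blocks -/

/-- The mean of `F x` over all `x` of length `N`. -/
noncomputable def unifMean (N : ℕ) (F : List Bool → ℝ) : ℝ :=
  (∑ x : Fin N → Bool, F (List.ofFn x)) / 2 ^ N

theorem unifMean_zero (F : List Bool → ℝ) : unifMean 0 F = F [] := by simp [unifMean]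

theorem unifMean_succ (N : ℕ) (F : List Bool → ℝ) :
    unifMean (N + 1) F =
      (unifMean N (fun x => F (false :: x)) + unifMean N (fun x => F (true :: x))) / 2 := by
  have : ∑ x : Fin (N + 1) → Bool, F (List.ofFn x) =
      ∑ x : Fin N → Bool, F (false :: List.ofFn x) + ∑ x : Fin N → Bool, F (true :: List.ofFn x) := by
    rw [← (Fin.consEquiv (fun _ => Bool)).sum_comp, Fintype.sum_prod_type, Fintype.sum_bool, add_comm]
    simp [Fin.consEquiv, List.ofFn_succ]
  rw [unifMean, unifMean, unifMean, this, pow_succ]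
  field_simp

theorem unifMean_const (N : ℕ) (c : ℝ) : unifMean N (fun _ => c) = c := by
  simp [unifMean]

theorem unifMean_add (N : ℕ) (F G : List Bool → ℝ) :
    unifMean N (fun x => F x + G x) = unifMean N F + unifMean N G := by
  simp [unifMean, Finset.sum_add_distrib, add_div]

theorem unifMean_const_mul (N : ℕ) (c : ℝ) (F : List Bool → ℝ) :
    unifMean N (fun x => c * F x) = c * unifMean N F := by
  simp [unifMean, ← Finset.mul_sum, mul_div_assoc]

theorem unifMean_mono {N : ℕ} {F G : List Bool → ℝ} (h : ∀ x, x.length = N → F x ≤ G x) :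
    unifMean N F ≤ unifMean N G :=
  div_le_div_of_nonneg_right (Finset.sum_le_sum fun _ _ => h _ (by simp)) (by positivity)

theorem unifMean_append (M N : ℕ) (F : List Bool → ℝ) :
    unifMean (M + N) F = unifMean M (fun x => unifMean N (fun y => F (x ++ y))) := by
  induction M generalizing F with
  | zero => simp [unifMean_zero]
  | succ M ih => rw [Nat.add_right_comm, unifMean_succ, unifMean_succ, ih, ih]; rfl

/-- A surviving first bit matches the first bit of `y` with probability `1/2`, so the induction
closes with `p 2^(-k) + (1-p) 2^(-(k-1)) / 2 = 2^(-k)` for `k = y.length > 0`. -/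
theorem unifMean_prob_le {p : ℝ} (hp : p ∈ Set.Icc (0 : ℝ) 1) (N : ℕ) (y : List Bool) :
    unifMean N (fun x => prob p x y) ≤ (1 / 2) ^ y.length := by
  have hp0 := hp.1
  have hp1 : 0 ≤ 1 - p := sub_nonneg.2 hp.2
  induction N generalizing y with
  | zero =>
    rw [unifMean_zero, prob_nil]
    split_ifs with h
    · simp [h]
    · positivity
  | succ N ih =>
    rw [unifMean_succ]
    cases y with
    | nil =>
      have := ih []
      simp only [List.length_nil, pow_zero, prob_cons_nil, unifMean_const_mul] at this ⊢
      nlinarith [hp.2]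
    | cons c y =>
      have h1 := ih (c :: y)
      have h2 := ih y
      simp only [List.length_cons, pow_succ, prob_cons_cons, unifMean_add, unifMean_const_mul]
        at h1 h2 ⊢
      have h3 := mul_le_mul_of_nonneg_left h1 hp0
      have h4 := mul_le_mul_of_nonneg_left h2 hp1
      cases c <;> simp only [reduceCtorEq, if_true, if_false, unifMean_const] <;> linarith

theorem expect_length (p : ℝ) (x : List Bool) :
    expect p x (fun y => (y.length : ℝ)) = x.length * (1 - p) := by
  induction x with
  | nil => simp [expect]
  | cons b x ih =>
    simp only [expect, List.length_cons, Nat.cast_add, Nat.cast_one, expect_add, expect_const, ih]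
    ring

/-- The mean of `H(Y | X = x)` over the inputs `x` of length `N`. -/
noncomputable def meanCondEnt (p : ℝ) (N : ℕ) : ℝ := unifMean N (condEnt p)

theorem meanCondEnt_add_le {p : ℝ} (hp : p ∈ Set.Icc (0 : ℝ) 1) (M N : ℕ) :
    meanCondEnt p (M + N) ≤ meanCondEnt p M + meanCondEnt p N := by
  rw [meanCondEnt, unifMean_append, meanCondEnt, meanCondEnt,
    ← unifMean_const M (unifMean N (condEnt p)), ← unifMean_add]
  refine unifMean_mono fun x _ => ?_
  rw [← unifMean_const N (condEnt p x), ← unifMean_add]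
  exact unifMean_mono fun y _ => condEnt_append_le hp x y

theorem meanCondEnt_mul_le {p : ℝ} (hp : p ∈ Set.Icc (0 : ℝ) 1) (n Q : ℕ) :
    meanCondEnt p (n * Q) ≤ Q * meanCondEnt p n := by
  induction Q with
  | zero => simp [meanCondEnt, unifMean_zero, condEnt, expect, prob_nil]
  | succ Q ih =>
    rw [Nat.mul_succ]
    push_cast
    linarith [meanCondEnt_add_le hp (n * Q) n]

/-- By `unifMean_prob_le`, `-log` of the output probability is at least the output length, whose
mean is `N (1 - p)`. -/
theorem le_maxInfo {p : ℝ} (hp : p ∈ Set.Icc (0 : ℝ) 1) (N : ℕ) :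
    N * (1 - p) - meanCondEnt p N ≤ maxInfo N p := by
  have hs : (fun _ => 1 / 2 ^ N : (Fin N → Bool) → ℝ) ∈ stdSimplex ℝ (Fin N → Bool) :=
    ⟨fun _ => by positivity, by simp⟩
  refine le_trans ?_ (mutualInfo_le_maxInfo hs)
  have hQ : ∀ y, ∑ x : Fin N → Bool, 1 / 2 ^ N * prob p (List.ofFn x) y =
      unifMean N (fun x => prob p x y) := fun y => by
    rw [unifMean, ← Finset.mul_sum]; ring
  have hI : mutualInfo N p (fun _ => 1 / 2 ^ N) = unifMean N (fun x => expect p x (fun y =>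
      Real.logb 2 (prob p x y) - Real.logb 2 (unifMean N (fun x => prob p x y)))) := by
    rw [mutualInfo_eq_info, info, unifMean, ← Finset.mul_sum]
    simp only [hQ]
    ring
  have hle : ∀ x : Fin N → Bool, N * (1 - p) + -1 * condEnt p (List.ofFn x) ≤
      expect p (List.ofFn x) (fun y => Real.logb 2 (prob p (List.ofFn x) y) -
        Real.logb 2 (unifMean N (fun x => prob p x y))) := by
    intro x
    have h1 : N * (1 - p) = expect p (List.ofFn x) (fun y => (y.length : ℝ)) := by
      simp [expect_length]
    rw [h1, condEnt, neg_one_mul, neg_neg, ← expect_add]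
    refine expect_mono_of_prob_pos hp fun y hy => ?_
    have hpos : 0 < unifMean N (fun x => prob p x y) :=
      div_pos (hy.trans_le (Finset.single_le_sum
        (f := fun x : Fin N → Bool => prob p (List.ofFn x) y)
        (fun j _ => prob_nonneg hp _ _) (Finset.mem_univ x))) (by positivity)
    have h2 := Real.logb_le_logb_of_le (b := 2) (by norm_num) hpos (unifMean_prob_le hp N y)
    have h3 : Real.logb 2 ((1 / 2) ^ y.length) = -(y.length : ℝ) := by
      rw [Real.logb_pow, one_div, Real.logb_inv, Real.logb_self_eq_one (by norm_num)]
      ring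
    linarith
  rw [hI, sub_eq_add_neg, ← neg_one_mul, meanCondEnt, ← unifMean_const_mul,
    ← unifMean_const N ((N : ℝ) * (1 - p)), ← unifMean_add]
  exact div_le_div_of_nonneg_right (Finset.sum_le_sum fun x _ => hle x) (by positivity)

theorem le_capacity {p : ℝ} (hp : p ∈ Set.Icc (0 : ℝ) 1) {n : ℕ} (hn : 0 < n) :
    1 - p - meanCondEnt p n / n ≤ capacity p := by
  have hn' : (0 : ℝ) < n := Nat.cast_pos.2 hn
  -- The limit is evaluated along multiples of `n`; `Q + 1` avoids the empty input.
  have ht : Tendsto (fun Q : ℕ => n * (Q + 1)) atTop atTop :=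
    (tendsto_add_atTop_nat 1).const_mul_atTop' hn
  refine ge_of_tendsto' ((tendsto_maxInfo_div hp).comp ht) fun Q => ?_
  have h1 := le_maxInfo hp (n * (Q + 1))
  have h2 := meanCondEnt_mul_le hp n (Q + 1)
  simp only [Function.comp_apply]
  push_cast at h1 h2 ⊢
  rw [le_div_iff₀ (by positivity)]
  have h3 : (1 - p - meanCondEnt p n / n) * (n * (Q + 1)) =
      n * (Q + 1) * (1 - p) - (Q + 1) * meanCondEnt p n := by
    field_simp
  linarith

/-! ### Bernstein polynomials as binomial expectations -/

/-- The Bernstein polynomial `∑ i, C(l, i) p ^ i (1 - p) ^ (l - i) c i` of a sequence `c`. -/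
def bern : ℕ → (ℕ → ℝ) → ℝ → ℝ
  | 0, c, _ => c 0
  | l + 1, c, p => (1 - p) * bern l c p + p * bern l (fun i => c (i + 1)) p

theorem bern_eq_sum (l : ℕ) (c : ℕ → ℝ) (p : ℝ) :
    bern l c p = ∑ i ∈ Finset.range (l + 1), (l.choose i : ℝ) * p ^ i * (1 - p) ^ (l - i) * c i := by
  have h : bern l c p = ∑ ij ∈ Finset.HasAntidiagonal.antidiagonal l,
      (l.choose ij.1 : ℝ) * (p ^ ij.1 * (1 - p) ^ ij.2 * c ij.1) := by
    induction l generalizing c with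
    | zero => simp [bern]
    | succ l ih =>
      rw [Finset.sum_antidiagonal_choose_succ_mul (fun i j => p ^ i * (1 - p) ^ j * c i), bern, ih, ih,
        Finset.mul_sum, Finset.mul_sum]
      congr 1 <;> refine Finset.sum_congr rfl fun ij hij => ?_
      · ring
      · rw [Nat.choose_symm_of_eq_add (Finset.HasAntidiagonal.mem_antidiagonal.1 hij).symm]
        ring
  rw [h, Finset.Nat.sum_antidiagonal_eq_sum_range_succ
    (fun i j => (l.choose i : ℝ) * (p ^ i * (1 - p) ^ j * c i))]
  exact Finset.sum_congr rfl fun i _ => by ring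

theorem bern_congr {l : ℕ} {c d : ℕ → ℝ} (h : ∀ i ≤ l, c i = d i) (p : ℝ) :
    bern l c p = bern l d p := by
  rw [bern_eq_sum, bern_eq_sum]
  exact Finset.sum_congr rfl fun i hi => by rw [h i (Finset.mem_range_succ_iff.1 hi)]

theorem bern_const (l : ℕ) (a p : ℝ) : bern l (fun _ => a) p = a := by
  induction l with
  | zero => rfl
  | succ l ih => rw [bern, ih]; ring

theorem bern_add (l : ℕ) (c d : ℕ → ℝ) (p : ℝ) :
    bern l (fun i => c i + d i) p = bern l c p + bern l d p := by
  induction l generalizing c d with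
  | zero => rfl
  | succ l ih => simp only [bern, ih]; ring

theorem bern_const_mul (l : ℕ) (a : ℝ) (c : ℕ → ℝ) (p : ℝ) :
    bern l (fun i => a * c i) p = a * bern l c p := by
  induction l generalizing c with
  | zero => rfl
  | succ l ih => simp only [bern, ih]; ring

theorem bern_sub (l : ℕ) (c d : ℕ → ℝ) (p : ℝ) :
    bern l (fun i => c i - d i) p = bern l c p - bern l d p := by
  induction l generalizing c d with
  | zero => rfl
  | succ l ih => simp only [bern, ih]; ring

theorem bern_cast (l : ℕ) (p : ℝ) : bern l (fun i => (i : ℝ)) p = l * p := by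
  induction l with
  | zero => simp [bern]
  | succ l ih => simp only [bern, Nat.cast_add, bern_add, bern_const, ih]; push_cast; ring

theorem bern_nonpos {l : ℕ} {c : ℕ → ℝ} (hc : ∀ i ≤ l, c i ≤ 0) {p : ℝ}
    (hp : p ∈ Set.Icc (0 : ℝ) 1) : bern l c p ≤ 0 := by
  rw [bern_eq_sum]
  have := hp.1
  have : 0 ≤ 1 - p := sub_nonneg.2 hp.2
  exact Finset.sum_nonpos fun i hi =>
    mul_nonpos_of_nonneg_of_nonpos (by positivity) (hc i (Finset.mem_range_succ_iff.1 hi))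

theorem bern_one_sub (l : ℕ) (c : ℕ → ℝ) (p : ℝ) :
    bern l c (1 - p) = bern l (fun i => c (l - i)) p := by
  rw [bern_eq_sum, bern_eq_sum, ← Finset.sum_range_reflect]
  refine Finset.sum_congr rfl fun i hi => ?_
  have hi' : i ≤ l := Finset.mem_range_succ_iff.1 hi
  rw [Nat.add_sub_cancel, Nat.sub_sub_self hi', Nat.choose_symm hi', sub_sub_cancel]
  ring

theorem hasDerivAt_bern (l : ℕ) (c : ℕ → ℝ) (p : ℝ) :
    HasDerivAt (bern l c) (l * bern (l - 1) (fun i => c (i + 1) - c i) p) p := by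
  induction l generalizing c with
  | zero => simpa [bern] using hasDerivAt_const p (c 0)
  | succ l ih =>
    have h1 := ((hasDerivAt_const p (1 : ℝ)).sub (hasDerivAt_id p)).mul (ih c)
    have h2 := (hasDerivAt_id p).mul (ih fun i => c (i + 1))
    refine (h1.add h2).congr_deriv ?_
    simp only [Nat.add_sub_cancel, Pi.sub_apply, id]
    have h3 : bern l (fun i => c (i + 1) - c i) p = bern l (fun i => c (i + 1)) p - bern l c p :=
      bern_sub _ _ _ _
    cases l with
    | zero =>
      simp [bern]
      ring
    | succ l =>
      have h4 : bern (l + 1) (fun i => c (i + 1) - c i) p =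
          (1 - p) * bern l (fun i => c (i + 1) - c i) p +
            p * bern l (fun i => c (i + 1 + 1) - c (i + 1)) p := rfl
      rw [h4] at h3 ⊢
      simp only [Nat.add_sub_cancel]
      push_cast
      linear_combination -h3

/-- Differentiation replaces the coefficients by their differences, so nonpositive second
differences give a nonpositive second derivative. -/
theorem concaveOn_bern {l : ℕ} {c : ℕ → ℝ}
    (hc : ∀ i, i + 2 ≤ l → c (i + 2) - c (i + 1) - (c (i + 1) - c i) ≤ 0) :
    ConcaveOn ℝ (Set.Icc 0 1) (bern l c) := by
  have h1 : deriv (bern l c) = fun p => l * bern (l - 1) (fun i => c (i + 1) - c i) p :=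
    funext fun p => (hasDerivAt_bern l c p).deriv
  have h2 : ∀ p, HasDerivAt (deriv (bern l c)) (l * ((l - 1 : ℕ) * bern (l - 1 - 1)
      (fun i => c (i + 1 + 1) - c (i + 1) - (c (i + 1) - c i)) p)) p := fun p => by
    rw [h1]
    exact (hasDerivAt_bern _ _ p).const_mul _
  refine concaveOn_of_deriv2_nonpos' (convex_Icc 0 1)
    (fun p _ => (hasDerivAt_bern l c p).differentiableAt.differentiableWithinAt)
    (fun p _ => (h2 p).differentiableAt.differentiableWithinAt) fun p hp => ?_
  rw [Function.iterate_succ_apply, Function.iterate_one, (h2 p).deriv]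
  rcases Nat.lt_or_ge l 2 with hl | hl
  · interval_cases l <;> simp
  · exact mul_nonpos_of_nonneg_of_nonpos (by positivity) (mul_nonpos_of_nonneg_of_nonpos
      (by positivity) (bern_nonpos (fun i hi => hc i (by omega)) hp))

/-! ### Log-concavity of binomial coefficients and the entropy of one run -/

theorem choose_mul_choose_le (l i : ℕ) :
    l.choose i * l.choose (i + 2) ≤ l.choose (i + 1) * l.choose (i + 1) := by
  rcases Nat.lt_or_ge l (i + 2) with hl | hl
  · simp [Nat.choose_eq_zero_of_lt hl]
  · obtain ⟨d, rfl⟩ := Nat.exists_eq_add_of_le hl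
    have h1 := Nat.choose_succ_right_eq (i + 2 + d) i
    have h2 := Nat.choose_succ_right_eq (i + 2 + d) (i + 1)
    rw [show i + 2 + d - i = d + 2 by omega] at h1
    rw [show i + 2 + d - (i + 1) = d + 1 by omega] at h2
    set a := (i + 2 + d).choose i
    set b := (i + 2 + d).choose (i + 1)
    set e := (i + 2 + d).choose (i + 2)
    -- The two consecutive ratios of binomial coefficients, cross-multiplied with `l - i = d + 2`.
    have h3 : a * e * ((i + 2) * (d + 2)) = b * b * ((i + 1) * (d + 1)) := by
      calc _ = (a * (d + 2)) * (e * (i + 2)) := by ring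
        _ = _ := by rw [← h1, h2]; ring
    have h4 : b * b * ((i + 1) * (d + 1)) ≤ b * b * ((i + 2) * (d + 2)) := by gcongr <;> omega
    exact Nat.le_of_mul_le_mul_right (h3.trans_le h4) (by positivity)

/-- The mean of `log C(l, J)` for a binomially distributed number `J` of deletions in a run of
length `l`. -/
noncomputable def runGain (p : ℝ) (l : ℕ) : ℝ := bern l (fun i => Real.logb 2 (l.choose i)) p

theorem concaveOn_runGain (l : ℕ) : ConcaveOn ℝ (Set.Icc 0 1) (fun p => runGain p l) := by
  refine concaveOn_bern fun i hi => ?_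
  have h0 : (0 : ℝ) < l.choose i := Nat.cast_pos.2 (Nat.choose_pos (by omega))
  have h1 : (0 : ℝ) < l.choose (i + 1) := Nat.cast_pos.2 (Nat.choose_pos (by omega))
  have h2 : (0 : ℝ) < l.choose (i + 2) := Nat.cast_pos.2 (Nat.choose_pos (by omega))
  have h := Real.logb_le_logb_of_le (b := 2) (by norm_num) (mul_pos h0 h2)
    (show (l.choose i : ℝ) * l.choose (i + 2) ≤ l.choose (i + 1) * l.choose (i + 1) by
      exact_mod_cast choose_mul_choose_le l i)
  rw [Real.logb_mul h0.ne' h2.ne', Real.logb_mul h1.ne' h1.ne'] at h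
  linarith

/-- The argument is `1 - p` because `k` counts surviving bits; `bern_one_sub` later passes to
deletions. -/
theorem expect_replicate (p : ℝ) (l : ℕ) (b : Bool) (f : List Bool → ℝ) :
    expect p (List.replicate l b) f = bern l (fun k => f (List.replicate k b)) (1 - p) := by
  induction l generalizing f with
  | zero => rfl
  | succ l ih => simp only [List.replicate_succ, expect, bern, ih]; ring

theorem prob_replicate (p : ℝ) {l k : ℕ} (hk : k ≤ l) (b : Bool) :
    prob p (List.replicate l b) (List.replicate k b) =
      (l.choose k : ℝ) * (1 - p) ^ k * p ^ (l - k) := by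
  have h : ∀ j, (List.replicate j b = List.replicate k b) ↔ j = k := fun j => by
    simp [List.replicate_inj]
  rw [prob, expect_replicate, bern_eq_sum]
  simp [h, Nat.lt_succ_iff.2 hk]

theorem condEnt_replicate (p : ℝ) (l : ℕ) (b : Bool) :
    condEnt p (List.replicate l b) = l * Hb p - runGain p l := by
  have h1 : expect p (List.replicate l b) (fun y => Real.logb 2 (prob p (List.replicate l b) y)) =
      bern l (fun k => Real.logb 2 (l.choose k) + (Real.logb 2 (1 - p) * k +
        Real.logb 2 p * (l - k))) (1 - p) := by
    rw [expect_replicate, bern_eq_sum, bern_eq_sum]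
    refine Finset.sum_congr rfl fun k hk => ?_
    have hk' : k ≤ l := Finset.mem_range_succ_iff.1 hk
    rw [prob_replicate p hk', sub_sub_cancel]
    -- Terms of zero weight, as for `p = 0` or `p = 1`, are dropped before the logarithm is
    -- expanded.
    by_cases h0 : (l.choose k : ℝ) * (1 - p) ^ k * p ^ (l - k) = 0
    · simp [h0]
    · have h2 := right_ne_zero_of_mul h0
      have h3 := left_ne_zero_of_mul h0
      rw [Real.logb_mul h3 h2, Real.logb_mul (left_ne_zero_of_mul h3) (right_ne_zero_of_mul h3),
        Real.logb_pow, Real.logb_pow, Nat.cast_sub hk']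
      ring
  have h2 : bern l (fun k => Real.logb 2 (l.choose k)) (1 - p) = runGain p l := by
    rw [bern_one_sub, runGain]
    exact bern_congr (fun i hi => by rw [Nat.choose_symm hi]) p
  rw [condEnt, h1, bern_add, h2, bern_add, bern_const_mul, bern_const_mul, bern_sub, bern_const,
    bern_cast, Hb]
  ring

/-! ### Run statistics of a uniform block -/

/-- The mean of `∑ u l` over the lengths `l` of the runs of a uniformly distributed sequence of
length `n`. -/
noncomputable def runMean (n : ℕ) (u : ℕ → ℝ) : ℝ :=
  ∑ l ∈ Finset.Icc 1 (n - 1), (2 : ℝ) ^ (-(l : ℤ) - 1) * ((n : ℝ) - l + 3) * u l +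
    (2 : ℝ) ^ (-(n : ℤ) + 1) * u n

theorem two_zpow_neg (n : ℕ) : (2 : ℝ) ^ (-(n : ℤ)) = (1 / 2) ^ n := by simp

theorem runMean_succ (m : ℕ) (u : ℕ → ℝ) :
    runMean (m + 1) u =
      ∑ l ∈ Finset.range m, (1 / 2 : ℝ) ^ (l + 2) * ((m : ℝ) - l + 3) * u (l + 1) +
        (1 / 2) ^ m * u (m + 1) := by
  have h : Finset.Icc 1 m = Finset.Ico (0 + 1) (m + 1) := by ext; simp
  rw [runMean, Nat.add_sub_cancel, Finset.range_eq_Ico, h, ← Finset.sum_Ico_add'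
    (fun l : ℕ => (2 : ℝ) ^ (-(l : ℤ) - 1) * (((m + 1 : ℕ) : ℝ) - l + 3) * u l) 0 m 1]
  have h2 : (2 : ℝ) ^ (-((m + 1 : ℕ) : ℤ) + 1) = (1 / 2) ^ m := by
    rw [← two_zpow_neg]; congr 1; push_cast; ring
  rw [h2]
  congr 1
  refine Finset.sum_congr rfl fun l _ => ?_
  have h3 : (2 : ℝ) ^ (-((l + 1 : ℕ) : ℤ) - 1) = (1 / 2) ^ (l + 2) := by
    rw [← two_zpow_neg]; congr 1
  rw [h3]
  push_cast
  ring

/-- Part of a run, of length `k` so far, followed by `m` uniformly distributed bits. -/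
noncomputable def partialRunMean (u : ℕ → ℝ) (k m : ℕ) : ℝ :=
  ∑ i ∈ Finset.range m, (1 / 2 : ℝ) ^ (i + 1) * u (k + i) + (1 / 2) ^ m * u (k + m) +
    ∑ l ∈ Finset.range m, (1 / 2 : ℝ) ^ (l + 2) * ((m : ℝ) - l + 1) * u (l + 1)

/-- The next bit either lengthens the current run or closes it at length `k` and starts a new one,
each with probability `1/2`. -/
theorem partialRunMean_succ (u : ℕ → ℝ) (k m : ℕ) :
    partialRunMean u k (m + 1) =
      (partialRunMean u (k + 1) m + (u k + partialRunMean u 1 m)) / 2 := by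
  have h1 : ∑ l ∈ Finset.range m, (1 / 2 : ℝ) ^ (l + 2) * (((m + 1 : ℕ) : ℝ) - l + 1) * u (l + 1) =
      ∑ l ∈ Finset.range m, (1 / 2 : ℝ) ^ (l + 2) * ((m : ℝ) - l + 1) * u (l + 1) +
      (∑ l ∈ Finset.range m, (1 / 2 : ℝ) ^ (l + 1) * u (1 + l)) / 2 := by
    rw [Finset.sum_div, ← Finset.sum_add_distrib]
    refine Finset.sum_congr rfl fun l _ => ?_
    rw [add_comm 1 l]
    push_cast
    ring
  have h2 : ∑ i ∈ Finset.range m, (1 / 2 : ℝ) ^ (i + 1 + 1) * u (k + (i + 1)) =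
      (∑ i ∈ Finset.range m, (1 / 2 : ℝ) ^ (i + 1) * u (k + 1 + i)) / 2 := by
    rw [Finset.sum_div]
    refine Finset.sum_congr rfl fun i _ => ?_
    rw [show k + (i + 1) = k + 1 + i by ring]
    ring
  rw [partialRunMean, Finset.sum_range_succ', h2, Finset.sum_range_succ, h1, partialRunMean,
    partialRunMean, add_comm 1 m, show k + 1 + m = k + (m + 1) by ring, add_zero]
  push_cast
  ring

theorem partialRunMean_one (u : ℕ → ℝ) (m : ℕ) : partialRunMean u 1 m = runMean (m + 1) u := by
  rw [partialRunMean, runMean_succ, add_right_comm, ← Finset.sum_add_distrib, add_comm 1 m]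
  congr 1
  refine Finset.sum_congr rfl fun l _ => ?_
  rw [add_comm 1 l]
  ring

/-- Follows the recursion of `partialRunMean`, paying subadditivity each time a run closes. Starting
at `k = 1` covers a whole block. -/
theorem unifMean_condEnt_le {p : ℝ} (hp : p ∈ Set.Icc (0 : ℝ) 1) (b : Bool) (k m : ℕ) :
    unifMean m (fun x => condEnt p (List.replicate k b ++ x)) ≤
      partialRunMean (fun l => l * Hb p - runGain p l) k m := by
  induction m generalizing b k with
  | zero => simp [unifMean_zero, partialRunMean, condEnt_replicate]
  | succ m ih =>
    have h1 : ∀ x, List.replicate k b ++ b :: x = List.replicate (k + 1) b ++ x := fun x => by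
      rw [List.replicate_succ', List.append_assoc]; rfl
    have h2 : unifMean m (fun x => condEnt p (List.replicate k b ++ (!b) :: x)) ≤
        (k * Hb p - runGain p k) + unifMean m (fun x => condEnt p (List.replicate 1 (!b) ++ x)) := by
      rw [← condEnt_replicate p k b, ← unifMean_const m (condEnt p (List.replicate k b)),
        ← unifMean_add]
      exact unifMean_mono fun x _ => condEnt_append_le hp _ _
    have h3 := ih b (k + 1)
    have h4 := ih (!b) 1
    have h5 : unifMean (m + 1) (fun x => condEnt p (List.replicate k b ++ x)) =
        (unifMean m (fun x => condEnt p (List.replicate (k + 1) b ++ x)) +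
          unifMean m (fun x => condEnt p (List.replicate k b ++ (!b) :: x))) / 2 := by
      rw [unifMean_succ]
      simp only [← h1]
      cases b
      · rfl
      · rw [add_comm]; rfl
    rw [h5, partialRunMean_succ]
    linarith

theorem runMean_sub (n : ℕ) (u v : ℕ → ℝ) :
    runMean n (fun l => u l - v l) = runMean n u - runMean n v := by
  simp only [runMean, mul_sub, Finset.sum_sub_distrib]; ring

theorem runMean_mul_const (n : ℕ) (u : ℕ → ℝ) (a : ℝ) :
    runMean n (fun l => u l * a) = runMean n u * a := by
  simp only [runMean, ← mul_assoc, ← Finset.sum_mul]; ring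

theorem runMean_add_one_sub (m : ℕ) (u : ℕ → ℝ) :
    runMean (m + 2) u = runMean (m + 1) u +
      (∑ l ∈ Finset.range m, (1 / 2 : ℝ) ^ (l + 2) * u (l + 1) + (1 / 2) ^ (m + 1) * u (m + 2)) := by
  have : ∑ l ∈ Finset.range m, (1 / 2 : ℝ) ^ (l + 2) * (((m + 1 : ℕ) : ℝ) - l + 3) * u (l + 1) =
      ∑ l ∈ Finset.range m, (1 / 2 : ℝ) ^ (l + 2) * ((m : ℝ) - l + 3) * u (l + 1) +
      ∑ l ∈ Finset.range m, (1 / 2 : ℝ) ^ (l + 2) * u (l + 1) := by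
    rw [← Finset.sum_add_distrib]
    refine Finset.sum_congr rfl fun l _ => ?_
    push_cast
    ring
  rw [runMean_succ, runMean_succ, Finset.sum_range_succ, this]
  push_cast
  ring

/-- The run lengths of a block add up to `n`. -/
theorem runMean_cast {n : ℕ} (hn : 0 < n) : runMean n (fun l => (l : ℝ)) = n := by
  obtain ⟨m, rfl⟩ := Nat.exists_eq_succ_of_ne_zero hn.ne'
  have h : ∀ m : ℕ, ∑ l ∈ Finset.range m, (1 / 2 : ℝ) ^ (l + 2) * ((l + 1 : ℕ) : ℝ) =
      1 - (m + 2) * (1 / 2) ^ (m + 1) := fun m => by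
    induction m with
    | zero => norm_num
    | succ m ih => rw [Finset.sum_range_succ, ih]; push_cast; ring
  induction m with
  | zero => simp [runMean]
  | succ m ih =>
    rw [Nat.succ_eq_add_one, runMean_add_one_sub, h, ih (Nat.succ_pos m)]
    push_cast
    ring

theorem meanCondEnt_le {p : ℝ} (hp : p ∈ Set.Icc (0 : ℝ) 1) {n : ℕ} (hn : 0 < n) :
    meanCondEnt p n ≤ n * Hb p - runMean n (runGain p) := by
  rw [← runMean_cast hn, ← runMean_mul_const, ← runMean_sub]
  obtain ⟨m, rfl⟩ := Nat.exists_eq_succ_of_ne_zero hn.ne'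
  have h1 := unifMean_condEnt_le hp false 1 m
  have h2 := unifMean_condEnt_le hp true 1 m
  rw [partialRunMean_one] at h1 h2
  rw [meanCondEnt, Nat.succ_eq_add_one, unifMean_succ]
  have h3 : ∀ (b : Bool) (x : List Bool), b :: x = List.replicate 1 b ++ x := fun _ _ => rfl
  simp only [h3]
  linarith

/-! ### Identification with the coefficients `W j n` -/

/-- Among `l + m` independent trials, sorted by the total `j` of deletions, the number falling in
the first `l` is still binomial with parameters `l` and `p`. -/
theorem bern_eq_sum_convolution (l m : ℕ) (c : ℕ → ℝ) (p : ℝ) :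
    ∑ j ∈ Finset.range (l + m + 1), (∑ i ∈ Finset.range (j + 1),
      (l.choose i : ℝ) * (m.choose (j - i) : ℝ) * c i) * p ^ j * (1 - p) ^ (l + m - j) =
      bern l c p := by
  have h1 : ∀ j ∈ Finset.range (l + m + 1), (∑ i ∈ Finset.range (j + 1),
      (l.choose i : ℝ) * (m.choose (j - i) : ℝ) * c i) * p ^ j * (1 - p) ^ (l + m - j) =
      ∑ i ∈ Finset.range (j + 1), (fun i k => (l.choose i : ℝ) * (m.choose k : ℝ) * c i *
        p ^ (i + k) * (1 - p) ^ (l + m - (i + k))) i (j - i) := by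
    intro j _
    rw [Finset.sum_mul, Finset.sum_mul]
    refine Finset.sum_congr rfl fun i hi => ?_
    simp only
    rw [Nat.add_sub_cancel' (Finset.mem_range_succ_iff.1 hi)]
  rw [Finset.sum_congr rfl h1, Finset.sum_range_diag_flip (l + m + 1) (fun i k => (l.choose i : ℝ) *
    (m.choose k : ℝ) * c i * p ^ (i + k) * (1 - p) ^ (l + m - (i + k))), bern_eq_sum]
  symm
  refine Finset.sum_subset_zero_on_sdiff (Finset.range_mono (by omega)) (fun i hi => ?_)
    fun i hi => ?_
  · have : l < i := by simp at hi; omega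
    simp [Nat.choose_eq_zero_of_lt this]
  · have hi' : i ≤ l := Finset.mem_range_succ_iff.1 hi
    have h2 : ∑ k ∈ Finset.range (m + 1), (m.choose k : ℝ) * p ^ k * (1 - p) ^ (m - k) * 1 = 1 := by
      rw [← bern_eq_sum m (fun _ => 1), bern_const]
    refine ((mul_one _).symm.trans (congrArg (_ * ·) h2.symm)).trans ?_
    rw [Finset.mul_sum]
    refine Finset.sum_subset_zero_on_sdiff (Finset.range_mono (by omega)) (fun k hk => ?_)
      fun k hk => ?_
    · have : m < k := by simp at hk; omega
      simp [Nat.choose_eq_zero_of_lt this]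
    · have hk' : k ≤ m := Finset.mem_range_succ_iff.1 hk
      rw [show l + m - (i + k) = (l - i) + (m - k) by omega, pow_add, pow_add]
      ring

theorem sum_Icc_one_eq_sum_range {g : ℕ → ℝ} (hg : g 0 = 0) (j : ℕ) :
    ∑ i ∈ Finset.Icc 1 j, g i = ∑ i ∈ Finset.range (j + 1), g i := by
  refine Finset.sum_subset_zero_on_sdiff (fun i hi => ?_) (fun i hi => ?_) fun _ _ => rfl
  · simp at hi ⊢; omega
  · have : i = 0 := by simp at hi; omega
    rw [this, hg]

theorem sum_W {n : ℕ} (p : ℝ) :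
    ∑ j ∈ Finset.Icc 1 n, W j n * (n.choose j : ℝ) * p ^ j * (1 - p) ^ (n - j) =
      runMean n (runGain p) := by
  have h1 : ∀ j ∈ Finset.Icc 1 n, W j n * (n.choose j : ℝ) * p ^ j * (1 - p) ^ (n - j) =
      ∑ l ∈ Finset.Icc 1 (n - 1), (2 : ℝ) ^ (-(l : ℤ) - 1) * ((n : ℝ) - l + 3) *
        ((∑ i ∈ Finset.range (j + 1),
          (l.choose i : ℝ) * ((n - l).choose (j - i) : ℝ) * Real.logb 2 (l.choose i : ℝ)) *
            p ^ j * (1 - p) ^ (n - j)) +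
      (2 : ℝ) ^ (-(n : ℤ) + 1) *
        ((n.choose j : ℝ) * p ^ j * (1 - p) ^ (n - j) * Real.logb 2 (n.choose j : ℝ)) := by
    intro j hj
    have h0 : (n.choose j : ℝ) ≠ 0 :=
      Nat.cast_ne_zero.2 (Nat.choose_pos (Finset.mem_Icc.1 hj).2).ne'
    have h2 : ∀ l : ℕ, ∑ i ∈ Finset.Icc 1 j,
        (l.choose i : ℝ) * ((n - l).choose (j - i) : ℝ) * Real.logb 2 (l.choose i : ℝ) =
        ∑ i ∈ Finset.range (j + 1),
        (l.choose i : ℝ) * ((n - l).choose (j - i) : ℝ) * Real.logb 2 (l.choose i : ℝ) :=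
      fun l => sum_Icc_one_eq_sum_range (by simp) j
    simp only [W, h2, ← mul_assoc, ← Finset.sum_mul]
    field_simp
  rw [Finset.sum_congr rfl h1, Finset.sum_add_distrib, Finset.sum_comm, runMean, ← Finset.mul_sum]
  congr 1
  · refine Finset.sum_congr rfl fun l hl => ?_
    obtain ⟨m, rfl⟩ : ∃ m, n = l + m := ⟨n - l, by simp at hl; omega⟩
    rw [← Finset.mul_sum, Nat.add_sub_cancel_left, runGain, ← bern_eq_sum_convolution l m]
    exact congrArg _ (sum_Icc_one_eq_sum_range (by simp) _)
  · rw [runGain, bern_eq_sum]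
    exact congrArg _ (sum_Icc_one_eq_sum_range (by simp) _)

theorem lowerBound_eq (n : ℕ) (p : ℝ) :
    lowerBound n p = 1 - p - Hb p + 1 / (n : ℝ) * runMean n (runGain p) := by
  rw [lowerBound, sum_W]

theorem lowerBound_le_capacity {p : ℝ} (hp : p ∈ Set.Icc (0 : ℝ) 1) {n : ℕ} (hn : 0 < n) :
    lowerBound n p ≤ capacity p := by
  refine le_trans ?_ (le_capacity hp hn)
  have hn' : (0 : ℝ) < n := Nat.cast_pos.2 hn
  have h := div_le_div_of_nonneg_right (meanCondEnt_le hp hn) hn'.le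
  rw [sub_div, mul_div_cancel_left₀ _ hn'.ne'] at h
  rw [lowerBound_eq, one_div_mul_eq_div]
  linarith

/-! ### Concavity of the gain and the threshold -/

theorem runMean_mono {n : ℕ} {u v : ℕ → ℝ} (h : ∀ l, u l ≤ v l) : runMean n u ≤ runMean n v := by
  refine add_le_add (Finset.sum_le_sum fun l hl => mul_le_mul_of_nonneg_left (h l) ?_)
    (mul_le_mul_of_nonneg_left (h n) (by positivity))
  have : (l : ℝ) ≤ n := Nat.cast_le.2 ((Finset.mem_Icc.1 hl).2.trans (Nat.sub_le n 1))
  have : (0 : ℝ) ≤ n - l + 3 := by linarith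
  positivity

theorem runMean_add (n : ℕ) (u v : ℕ → ℝ) :
    runMean n (fun l => u l + v l) = runMean n u + runMean n v := by
  simp only [runMean, mul_add, Finset.sum_add_distrib]; ring

theorem hasDerivAt_runMean {u : ℝ → ℕ → ℝ} {u' : ℕ → ℝ} {p : ℝ}
    (h : ∀ l, HasDerivAt (fun p => u p l) (u' l) p) (n : ℕ) :
    HasDerivAt (fun p => runMean n (u p)) (runMean n u') p :=
  (HasDerivAt.fun_sum fun l _ => (h l).const_mul _).add ((h n).const_mul _)

theorem bern_zero_right (l : ℕ) (c : ℕ → ℝ) : bern l c 0 = c 0 := by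
  induction l with
  | zero => rfl
  | succ l ih => simp [bern, ih]

theorem bern_one_right (l : ℕ) (c : ℕ → ℝ) : bern l c 1 = c l := by
  induction l generalizing c with
  | zero => rfl
  | succ l ih => simp [bern, ih]

theorem runGain_zero (l : ℕ) : runGain 0 l = 0 := by simp [runGain, bern_zero_right]

theorem runGain_one (l : ℕ) : runGain 1 l = 0 := by simp [runGain, bern_one_right]

theorem hasDerivAt_runGain_zero (l : ℕ) :
    HasDerivAt (fun p => runGain p l) (l * Real.logb 2 l) 0 := by
  exact (hasDerivAt_bern l (fun i => Real.logb 2 (l.choose i)) 0).congr_deriv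
    (by simp [bern_zero_right])

theorem runMean_zero (n : ℕ) : runMean n (fun _ => 0) = 0 := by simp [runMean]

/-- `n (L_n(p) - (1 - H_b(p)))`. -/
noncomputable def excess (n : ℕ) (p : ℝ) : ℝ := runMean n (runGain p) - n * p

theorem concaveOn_excess (n : ℕ) : ConcaveOn ℝ (Set.Icc 0 1) (excess n) := by
  refine ⟨convex_Icc 0 1, fun x hx y hy a b ha hb hab => ?_⟩
  have h : runMean n (fun l => runGain x l * a + runGain y l * b) ≤
      runMean n (runGain (a • x + b • y)) := runMean_mono fun l => by
    have := (concaveOn_runGain l).2 hx hy ha hb hab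
    simp only [smul_eq_mul] at this ⊢
    linarith
  rw [runMean_add, runMean_mul_const, runMean_mul_const] at h
  simp only [excess, smul_eq_mul] at h ⊢
  linarith

theorem excess_zero (n : ℕ) : excess n 0 = 0 := by
  simp [excess, funext runGain_zero, runMean_zero]

theorem excess_one (n : ℕ) : excess n 1 = -n := by
  simp [excess, funext runGain_one, runMean_zero]

theorem hasDerivAt_excess_zero (n : ℕ) :
    HasDerivAt (excess n) (runMean n (fun l => l * Real.logb 2 l) - n) 0 :=
  ((hasDerivAt_runMean hasDerivAt_runGain_zero n).sub
    ((hasDerivAt_id (0 : ℝ)).const_mul (n : ℝ))).congr_deriv (by simp)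

theorem continuous_excess (n : ℕ) : Continuous (excess n) := by
  have h : ∀ l, Continuous fun p => runGain p l := fun l =>
    continuous_iff_continuousAt.2 fun p => (hasDerivAt_bern l _ p).continuousAt
  unfold excess runMean
  fun_prop

/-- The positive slope at `0` yields a point `q` with positive excess, and the intermediate value
theorem a zero `t` beyond it. Chords through `0`, `q` and `t` then decide every other sign. -/
theorem exists_threshold {n : ℕ} (hn : 0 < n)
    (hd : (n : ℝ) < runMean n (fun l => l * Real.logb 2 l)) :
    ∃ t ∈ Set.Ioo (0 : ℝ) 1, ∀ p ∈ Set.Ioc (0 : ℝ) 1, 0 < excess n p ↔ p < t := by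
  have hn' : (0 : ℝ) < n := Nat.cast_pos.2 hn
  obtain ⟨q, hq, hq0, hq1⟩ : ∃ q, 0 < excess n q ∧ 0 < q ∧ q < 1 := by
    have h1 := (hasDerivAt_excess_zero n).tendsto_slope_zero_right
    simp only [zero_add, excess_zero, sub_zero, smul_eq_mul] at h1
    obtain ⟨q, h2, h3⟩ := ((h1.eventually_const_lt (sub_pos.2 hd)).and
      (Ioo_mem_nhdsGT (zero_lt_one (α := ℝ)))).exists
    exact ⟨q, pos_of_mul_pos_right h2 (inv_nonneg.2 h3.1.le), h3.1, h3.2⟩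
  obtain ⟨t, ht, ht0⟩ := intermediate_value_Icc' hq1.le (continuous_excess n).continuousOn
    (show (0 : ℝ) ∈ Set.Icc (excess n 1) (excess n q) from
      ⟨by rw [excess_one]; linarith, hq.le⟩)
  have htq : q < t := lt_of_le_of_ne ht.1 fun h => by rw [h, ht0] at hq; exact lt_irrefl _ hq
  have ht1 : t < 1 := lt_of_le_of_ne ht.2 fun h => by
    rw [h, excess_one] at ht0; linarith
  -- The three-point form of concavity, with denominators cleared.
  have key : ∀ x ∈ Set.Icc (0 : ℝ) 1, ∀ z ∈ Set.Icc (0 : ℝ) 1, ∀ y, x < y → y < z →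
      (z - y) * excess n x + (y - x) * excess n z ≤ (z - x) * excess n y := by
    intro x hx z hz y hxy hyz
    have h := (concaveOn_excess n).2 hx hz
      (show 0 ≤ (z - y) / (z - x) from div_nonneg (by linarith) (by linarith))
      (show 0 ≤ (y - x) / (z - x) from div_nonneg (by linarith) (by linarith))
      (by rw [← add_div, div_eq_one_iff_eq (by linarith)]; ring)
    have hzx : z - x ≠ 0 := by linarith
    have e : ((z - y) / (z - x)) • x + ((y - x) / (z - x)) • z = y := by
      simp only [smul_eq_mul]; field_simp; ring
    rw [e] at h
    simp only [smul_eq_mul] at h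
    have h2 := mul_le_mul_of_nonneg_left h (show 0 ≤ z - x by linarith)
    calc _ = (z - x) * ((z - y) / (z - x) * excess n x + (y - x) / (z - x) * excess n z) := by
          field_simp
      _ ≤ _ := h2
  refine ⟨t, ⟨hq0.trans htq, ht1⟩, fun p hp => ⟨fun h => ?_, fun h => ?_⟩⟩
  · by_contra! hpt
    rcases hpt.eq_or_lt with rfl | hpt
    · linarith
    · have h1 := key q ⟨hq0.le, hq1.le⟩ p ⟨hp.1.le, hp.2⟩ t htq hpt
      rw [ht0] at h1
      nlinarith [mul_pos (sub_pos.2 hpt) hq, mul_pos (sub_pos.2 htq) h]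
  · rcases lt_trichotomy p q with hpq | rfl | hpq
    · have h1 := key 0 (by simp) q ⟨hq0.le, hq1.le⟩ p hp.1 hpq
      rw [excess_zero] at h1
      have : 0 < q * excess n p := by nlinarith [mul_pos hp.1 hq]
      exact pos_of_mul_pos_right this hq0.le
    · exact hq
    · have h1 := key q ⟨hq0.le, hq1.le⟩ t ⟨(hq0.trans htq).le, ht1.le⟩ p hpq h
      rw [ht0] at h1
      have : 0 < (t - q) * excess n p := by nlinarith [mul_pos (sub_pos.2 h) hq]
      exact pos_of_mul_pos_right this (by linarith)

/-! ### Numerical estimates of the slope and of the value at `1/10` -/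

theorem div_le_logb {a b N : ℕ} (hb : 0 < b) (h : 2 ^ a ≤ N ^ b) :
    (a : ℝ) / b ≤ Real.logb 2 N := by
  have hb' : (0 : ℝ) < b := Nat.cast_pos.2 hb
  have h1 := Real.logb_le_logb_of_le (b := 2) (by norm_num) (by positivity)
    (show (2 : ℝ) ^ a ≤ (N : ℝ) ^ b by exact_mod_cast h)
  rw [Real.logb_pow, Real.logb_pow, Real.logb_self_eq_one (by norm_num)] at h1
  rw [div_le_iff₀ hb']
  linarith

theorem logb_nat_nonneg (N : ℕ) : 0 ≤ Real.logb 2 N :=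
  div_nonneg (Real.log_natCast_nonneg N) (Real.log_nonneg (by norm_num))

theorem sum_range_le {u : ℕ → ℝ} (hu : ∀ l, 0 ≤ u l) {k m : ℕ} (h : k ≤ m) :
    ∑ l ∈ Finset.range k, u l ≤ ∑ l ∈ Finset.range m, u l :=
  Finset.sum_le_sum_of_subset_of_nonneg (Finset.range_mono h) fun _ _ _ => hu _

/-- From block length `k + 1` on, each increment of `runMean` is at least the partial sum in `h1`,
hence at least `a`; one checked length settles all larger ones. -/
theorem lt_runMean_of_le {u : ℕ → ℝ} (hu : ∀ l, 0 ≤ u l) {a : ℝ} {k : ℕ}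
    (h0 : (k + 1) * a < runMean (k + 1) u)
    (h1 : a ≤ ∑ l ∈ Finset.range k, (1 / 2 : ℝ) ^ (l + 2) * u (l + 1)) {n : ℕ} (hn : k + 1 ≤ n) :
    n * a < runMean n u := by
  induction n, hn using Nat.le_induction with
  | base => exact_mod_cast h0
  | succ n hn ih =>
    obtain ⟨m, rfl⟩ : ∃ m, n = m + 1 := ⟨n - 1, by omega⟩
    have h2 := h1.trans (sum_range_le (u := fun l => (1 / 2 : ℝ) ^ (l + 2) * u (l + 1))
      (fun l => mul_nonneg (by positivity) (hu _)) (show k ≤ m by omega))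
    have h3 : 0 ≤ (1 / 2 : ℝ) ^ (m + 1) * u (m + 2) := mul_nonneg (by positivity) (hu _)
    rw [runMean_add_one_sub]
    push_cast at ih ⊢
    linarith

theorem lt_runMean_mul_logb {n : ℕ} (hn : 7 ≤ n) :
    (n : ℝ) < runMean n (fun l => l * Real.logb 2 l) := by
  have h2 := div_le_logb (a := 1) (b := 1) (N := 2) (by norm_num) (by norm_num)
  have h3 := div_le_logb (a := 11) (b := 7) (N := 3) (by norm_num) (by norm_num)
  have h4 := div_le_logb (a := 2) (b := 1) (N := 4) (by norm_num) (by norm_num)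
  have h5 := div_le_logb (a := 16) (b := 7) (N := 5) (by norm_num) (by norm_num)
  have h6 := div_le_logb (a := 18) (b := 7) (N := 6) (by norm_num) (by norm_num)
  have h7 := div_le_logb (a := 14) (b := 5) (N := 7) (by norm_num) (by norm_num)
  rw [← mul_one (n : ℝ)]
  refine lt_runMean_of_le (k := 6) (fun l => mul_nonneg l.cast_nonneg (logb_nat_nonneg l)) ?_ ?_ hn
  · rw [runMean_succ]
    norm_num [Finset.sum_range_succ] at *
    linarith
  · norm_num [Finset.sum_range_succ] at *
    linarith

theorem runGain_nonneg {p : ℝ} (hp : p ∈ Set.Icc (0 : ℝ) 1) (l : ℕ) : 0 ≤ runGain p l := by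
  rw [runGain, bern_eq_sum]
  have := hp.1
  have : 0 ≤ 1 - p := sub_nonneg.2 hp.2
  exact Finset.sum_nonneg fun i _ => mul_nonneg (by positivity) (logb_nat_nonneg _)

/-- Keeps only one, two or three deletions in the run and rounds the logarithms down to twelfths. -/
theorem le_runGain {p : ℝ} (hp : p ∈ Set.Icc (0 : ℝ) 1) {l a b c : ℕ} (hl : 3 ≤ l)
    (ha : 2 ^ a ≤ l ^ 12) (hb : 2 ^ b ≤ l.choose 2 ^ 12) (hc : 2 ^ c ≤ l.choose 3 ^ 12) :
    l * p * (1 - p) ^ (l - 1) * (a / 12) + l.choose 2 * p ^ 2 * (1 - p) ^ (l - 2) * (b / 12) +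
      l.choose 3 * p ^ 3 * (1 - p) ^ (l - 3) * (c / 12) ≤ runGain p l := by
  have hp0 := hp.1
  have hp1 : 0 ≤ 1 - p := sub_nonneg.2 hp.2
  have ha' := div_le_logb (by norm_num) ha
  have hb' := div_le_logb (by norm_num) hb
  have hc' := div_le_logb (by norm_num) hc
  rw [runGain, bern_eq_sum]
  refine le_trans ?_ (sum_range_le (u := fun i => (l.choose i : ℝ) * p ^ i * (1 - p) ^ (l - i) *
    Real.logb 2 (l.choose i)) (fun i => mul_nonneg (by positivity) (logb_nat_nonneg _))
    (show 4 ≤ l + 1 by omega))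
  simp only [Finset.sum_range_succ, Finset.sum_range_zero, Nat.choose_zero_right, Nat.cast_one,
    Real.logb_one, mul_zero, zero_add, Nat.choose_one_right, pow_one]
  push_cast at ha' hb' hc'
  gcongr

theorem lt_runMean_runGain {n : ℕ} (hn : 11 ≤ n) : n * (1 / 10) < runMean n (runGain (1 / 10)) := by
  have hp : (1 / 10 : ℝ) ∈ Set.Icc (0 : ℝ) 1 := by norm_num
  have h1 := runGain_nonneg hp 1
  have h2 : (18 / 100 : ℝ) ≤ runGain (1 / 10) 2 := by
    rw [runGain, bern_eq_sum]; norm_num [Finset.sum_range_succ, Nat.choose]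
  -- Here and below `a`, `b`, `c` are the integer parts of `12 log₂ C(l, i)` for `i = 1, 2, 3`.
  have h3 := (show (42750 / 100000 : ℝ) ≤ _ by norm_num [Nat.choose]).trans
    (le_runGain hp (l := 3) (a := 19) (b := 19) (c := 0) (by norm_num) (by norm_num)
      (by norm_num [Nat.choose]) (by norm_num [Nat.choose]))
  have h4 := (show (71595 / 100000 : ℝ) ≤ _ by norm_num [Nat.choose]).trans
    (le_runGain hp (l := 4) (a := 24) (b := 31) (c := 24) (by norm_num) (by norm_num)
      (by norm_num [Nat.choose]) (by norm_num [Nat.choose]))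
  have h5 := (show (100136 / 100000 : ℝ) ≤ _ by norm_num [Nat.choose]).trans
    (le_runGain hp (l := 5) (a := 27) (b := 39) (c := 39) (by norm_num) (by norm_num)
      (by norm_num [Nat.choose]) (by norm_num [Nat.choose]))
  have h6 := (show (135448 / 100000 : ℝ) ≤ _ by norm_num [Nat.choose]).trans
    (le_runGain hp (l := 6) (a := 31) (b := 46) (c := 51) (by norm_num) (by norm_num)
      (by norm_num [Nat.choose]) (by norm_num [Nat.choose]))
  have h7 := (show (167710 / 100000 : ℝ) ≤ _ by norm_num [Nat.choose]).trans
    (le_runGain hp (l := 7) (a := 33) (b := 52) (c := 61) (by norm_num) (by norm_num)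
      (by norm_num [Nat.choose]) (by norm_num [Nat.choose]))
  have h8 := (show (204486 / 100000 : ℝ) ≤ _ by norm_num [Nat.choose]).trans
    (le_runGain hp (l := 8) (a := 36) (b := 57) (c := 69) (by norm_num) (by norm_num)
      (by norm_num [Nat.choose]) (by norm_num [Nat.choose]))
  have h9 := (show (239919 / 100000 : ℝ) ≤ _ by norm_num [Nat.choose]).trans
    (le_runGain hp (l := 9) (a := 38) (b := 62) (c := 76) (by norm_num) (by norm_num)
      (by norm_num [Nat.choose]) (by norm_num [Nat.choose]))
  have h10 := (show (270058 / 100000 : ℝ) ≤ _ by norm_num [Nat.choose]).trans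
    (le_runGain hp (l := 10) (a := 39) (b := 65) (c := 82) (by norm_num) (by norm_num)
      (by norm_num [Nat.choose]) (by norm_num [Nat.choose]))
  have h11 := (show (305653 / 100000 : ℝ) ≤ _ by norm_num [Nat.choose]).trans
    (le_runGain hp (l := 11) (a := 41) (b := 69) (c := 88) (by norm_num) (by norm_num)
      (by norm_num [Nat.choose]) (by norm_num [Nat.choose]))
  refine lt_runMean_of_le (k := 10) (runGain_nonneg hp) ?_ ?_ hn
  · rw [runMean_succ]
    norm_num [Finset.sum_range_succ] at *
    linarith
  · norm_num [Finset.sum_range_succ] at *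
    linarith

/-! ### Expansion for small deletion probability and the limit of `W 1 n` -/

theorem isBigO_bern_sub_linear (l : ℕ) (c : ℕ → ℝ) :
    (fun p => bern l c p - c 0 - l * (c 1 - c 0) * p) =O[𝓝 0] fun p => p ^ 2 := by
  induction l generalizing c with
  | zero => simpa [bern] using isBigO_zero _ _
  | succ l ih =>
    -- The recursion adds `p` times this difference of Bernstein polynomials; differentiability at
    -- `0` makes the error first order, hence second order after multiplication by `p`.
    have h1 : (fun p => bern l (fun i => c (i + 1)) p - bern l c p - (c 1 - c 0))
        =O[𝓝 0] fun p => p := by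
      have := ((hasDerivAt_bern l (fun i => c (i + 1)) 0).sub (hasDerivAt_bern l c 0)).isBigO_sub
      simpa [bern_zero_right] using this
    refine ((ih c).add (((isBigO_refl (fun p : ℝ => p) (𝓝 0)).mul h1).congr_right
      fun p => (sq p).symm)).congr_left fun p => ?_
    simp only [bern]
    push_cast
    ring

theorem isBigO_runMean_runGain (n : ℕ) :
    (fun p => runMean n (runGain p) - runMean n (fun l => l * Real.logb 2 l) * p)
      =O[𝓝 0] fun p => p ^ 2 := by
  have h : ∀ l : ℕ, (fun p => runGain p l - l * Real.logb 2 l * p) =O[𝓝 0] fun p => p ^ 2 :=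
    fun l => (isBigO_bern_sub_linear l (fun i => Real.logb 2 (l.choose i))).congr_left
      fun p => by simp [runGain]
  refine (IsBigO.add (IsBigO.sum (s := Finset.Icc 1 (n - 1)) fun l _ => (h l).const_mul_left
    ((2 : ℝ) ^ (-(l : ℤ) - 1) * ((n : ℝ) - l + 3)))
    ((h n).const_mul_left ((2 : ℝ) ^ (-(n : ℤ) + 1)))).congr_left fun p => ?_
  rw [← runMean_mul_const, ← runMean_sub, runMean, Finset.sum_apply]

theorem W_one {n : ℕ} (hn : 0 < n) :
    W 1 n = 1 / (n : ℝ) * runMean n (fun l => l * Real.logb 2 l) := by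
  have hn' : (n : ℝ) ≠ 0 := Nat.cast_ne_zero.2 hn.ne'
  simp only [W, runMean, Finset.Icc_self, Finset.sum_singleton, Nat.choose_one_right, Nat.sub_self,
    Nat.choose_zero_right, Nat.cast_one, mul_one]
  field_simp

theorem isBigO_one_sub_mul_log :
    (fun p : ℝ => (1 - p) * Real.log (1 - p) + p) =O[𝓝 0] fun p => p ^ 2 := by
  refine IsBigO.of_bound 4 ?_
  filter_upwards [Ioo_mem_nhds (show (-1 / 2 : ℝ) < 0 by norm_num) (show (0 : ℝ) < 1 / 2 by norm_num)]
    with p hp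
  have hp2 : |p| < 1 / 2 := abs_lt.2 ⟨by linarith [hp.1], hp.2⟩
  have h := Real.abs_log_sub_add_sum_range_le (show |p| < 1 by linarith) 1
  simp only [Finset.sum_range_one, zero_add, pow_one, Nat.cast_zero, div_one] at h
  have h2 : |p + Real.log (1 - p)| ≤ 2 * p ^ 2 := by
    refine h.trans ?_
    rw [div_le_iff₀ (by linarith), one_add_one_eq_two, sq_abs]
    nlinarith [sq_nonneg p]
  have h3 : (1 - p) * Real.log (1 - p) + p = (1 - p) * (p + Real.log (1 - p)) + p ^ 2 := by ring
  rw [h3, Real.norm_eq_abs, Real.norm_eq_abs, abs_of_nonneg (sq_nonneg p)]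
  refine (abs_add_le _ _).trans ?_
  rw [abs_mul, abs_of_nonneg (sq_nonneg p), abs_of_pos (show 0 < 1 - p by linarith [hp.2])]
  have h4 : (1 - p) * |p + Real.log (1 - p)| ≤ 3 / 2 * (2 * p ^ 2) :=
    mul_le_mul (by linarith [hp.1]) h2 (abs_nonneg _) (by norm_num)
  linarith

theorem logb_two_mul_exp_one : Real.logb 2 (2 * Real.exp 1) = 1 + 1 / Real.log 2 := by
  rw [Real.logb_mul (by norm_num) (Real.exp_ne_zero 1), Real.logb_self_eq_one (by norm_num),
    Real.logb, Real.log_exp]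

theorem isBigO_lowerBound {n : ℕ} (hn : 0 < n) :
    (fun p : ℝ => lowerBound n p -
        (1 + p * Real.logb 2 p - (Real.logb 2 (2 * Real.exp 1) - W 1 n) * p))
      =O[𝓝[>] 0] (fun p : ℝ => p ^ 2) := by
  refine IsBigO.mono (((isBigO_one_sub_mul_log.const_mul_left (1 / Real.log 2)).add
    ((isBigO_runMean_runGain n).const_mul_left (1 / (n : ℝ)))).congr_left fun p => ?_)
    nhdsWithin_le_nhds
  rw [lowerBound_eq, logb_two_mul_exp_one, W_one hn, Hb]
  simp only [Real.logb]
  ring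

/-- The case `k = 1` controls the `-l` in the weight `n - l + 3`. -/
theorem summable_pow_mul_logb (k : ℕ) :
    Summable (fun l : ℕ => (l : ℝ) ^ k * ((2 : ℝ) ^ (-(l : ℤ) - 1) * l * Real.logb 2 l)) := by
  have h := summable_pow_mul_geometric_of_norm_lt_one (k + 2) (r := (1 / 2 : ℝ)) (by norm_num)
  refine Summable.of_nonneg_of_le (fun l => ?_) (fun l => ?_) h
  · have := logb_nat_nonneg l
    positivity
  · have h1 : Real.logb 2 l ≤ l := by
      rcases l.eq_zero_or_pos with rfl | hl
      · simp
      · rw [Real.logb_le_iff_le_rpow (by norm_num) (Nat.cast_pos.2 hl), Real.rpow_natCast]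
        exact_mod_cast Nat.lt_two_pow_self.le
    have h2 : (2 : ℝ) ^ (-(l : ℤ) - 1) ≤ (1 / 2) ^ l := by
      rw [← two_zpow_neg]
      exact zpow_le_zpow_right₀ (by norm_num) (by omega)
    calc _ ≤ (l : ℝ) ^ k * ((1 / 2) ^ l * l * l) := by
          have := logb_nat_nonneg l
          gcongr
      _ = _ := by ring

theorem summable_mul_logb :
    Summable (fun l : ℕ => (2 : ℝ) ^ (-(l : ℤ) - 1) * l * Real.logb 2 l) := by
  simpa using summable_pow_mul_logb 0

/-- After division by `n`, the weight `n - l + 3` leaves the partial sums of the series plus `1/n`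
times a convergent sequence. -/
theorem tendsto_W_one :
    Tendsto (W 1) atTop (𝓝 (∑' l : ℕ, (2 : ℝ) ^ (-(l : ℤ) - 1) * l * Real.logb 2 l)) := by
  set a : ℕ → ℝ := fun l => (2 : ℝ) ^ (-(l : ℤ) - 1) * l * Real.logb 2 l
  have ha_apply : ∀ l, a l = (2 : ℝ) ^ (-(l : ℤ) - 1) * l * Real.logb 2 l := fun _ => rfl
  have h0 : Tendsto (fun n : ℕ => 1 / (n : ℝ)) atTop (𝓝 0) := tendsto_one_div_atTop_nhds_zero_nat
  have h1 := summable_mul_logb.hasSum.tendsto_sum_nat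
  have h2 := (summable_pow_mul_logb 1).hasSum.tendsto_sum_nat
  have h3 := summable_mul_logb.tendsto_atTop_zero
  have h4 := h1.add (h0.mul (((h1.const_mul 3).sub h2).add (h3.const_mul 4)))
  rw [zero_mul, add_zero] at h4
  refine h4.congr' ?_
  filter_upwards [eventually_gt_atTop 0] with n hn
  have hn' : (n : ℝ) ≠ 0 := Nat.cast_ne_zero.2 hn.ne'
  have h5 : ∑ l ∈ Finset.Icc 1 (n - 1), (2 : ℝ) ^ (-(l : ℤ) - 1) * ((n : ℝ) - l + 3) *
      (l * Real.logb 2 l) = ∑ l ∈ Finset.range n, (n * a l + (3 * a l - (l : ℝ) ^ 1 * a l)) := by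
    rw [sum_Icc_one_eq_sum_range (by simp), Nat.sub_add_cancel hn]
    refine Finset.sum_congr rfl fun l _ => ?_
    rw [ha_apply]
    ring
  have h6 : (2 : ℝ) ^ (-(n : ℤ) + 1) * (n * Real.logb 2 n) = 4 * a n := by
    have : (2 : ℝ) ^ (-(n : ℤ) + 1) = 4 * 2 ^ (-(n : ℤ) - 1) := by
      rw [show -(n : ℤ) + 1 = 2 + (-(n : ℤ) - 1) by ring, zpow_add₀ (by norm_num)]
      norm_num
    rw [this]
    rw [ha_apply]
    ring
  rw [W_one hn, runMean, h5, h6, Finset.sum_add_distrib, Finset.sum_sub_distrib, ← Finset.mul_sum,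
    ← Finset.mul_sum]
  simp only [← ha_apply]
  field_simp
  ring

theorem eventually_le_capacity {ε : ℝ} (hε : 0 < ε) :
    ∀ᶠ p in 𝓝[>] (0 : ℝ), 1 + p * Real.logb 2 p - (A₁ + ε) * p ≤ capacity p := by
  -- One half of `ε` pays for fixing a finite `n`, the other absorbs the quadratic error.
  obtain ⟨n, hW, hn⟩ := (((tendsto_W_one.const_sub (Real.logb 2 (2 * Real.exp 1))).eventually_lt_const
    (show A₁ < A₁ + ε / 2 by linarith)).and (eventually_gt_atTop 0)).exists
  have h1 := ((isBigO_lowerBound hn).trans_isLittleO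
    ((isLittleO_pow_id one_lt_two).mono nhdsWithin_le_nhds)).def (half_pos hε)
  filter_upwards [h1, Ioo_mem_nhdsGT (zero_lt_one (α := ℝ))] with p h2 hp
  refine le_trans ?_ (lowerBound_le_capacity ⟨hp.1.le, hp.2.le⟩ hn)
  rw [Real.norm_eq_abs, Real.norm_eq_abs, abs_of_pos hp.1] at h2
  have h3 := (abs_le.1 h2).1
  have h4 := mul_lt_mul_of_pos_right hW hp.1
  linarith

theorem one_sub_Hb_lt_lowerBound_iff {n : ℕ} (hn : 0 < n) (p : ℝ) :
    1 - Hb p < lowerBound n p ↔ 0 < excess n p := by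
  have hn' : (0 : ℝ) < n := Nat.cast_pos.2 hn
  have h : excess n p = n * (lowerBound n p - (1 - Hb p)) := by
    rw [lowerBound_eq, excess]; field_simp; ring
  rw [h, mul_pos_iff_of_pos_left hn', sub_pos]

end DeletionChannel

theorem mainTheorem3 :
    -- the limit that defines the capacity exists
    (∀ p ∈ Set.Icc (0 : ℝ) 1,
      Tendsto (fun N : ℕ => DeletionChannel.maxInfo N p / N) atTop
        (𝓝 (DeletionChannel.capacity p))) ∧
    -- the lower bound on the capacity
    (∀ p ∈ Set.Icc (0 : ℝ) 1, ∀ n : ℕ, 0 < n →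
      DeletionChannel.capacity p ≥ DeletionChannel.lowerBound n p) ∧
    -- strict improvement on `1 - H_b(p)`, exactly below a threshold `t`
    (∀ n : ℕ, 7 ≤ n → ∃ t ∈ Set.Ioo (0 : ℝ) 1, (11 ≤ n → 1 / 10 < t) ∧
      ∀ p ∈ Set.Ioc (0 : ℝ) 1,
        1 - DeletionChannel.Hb p < DeletionChannel.lowerBound n p ↔ p < t) ∧
    -- the expansion of the lower bound for small `p`
    (∀ n : ℕ, 0 < n →
      (fun p : ℝ => DeletionChannel.lowerBound n p -
        (1 + p * Real.logb 2 p -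
          (Real.logb 2 (2 * Real.exp 1) - DeletionChannel.W 1 n) * p))
        =O[𝓝[>] 0] (fun p : ℝ => p ^ 2)) ∧
    -- its first-order coefficient tends to `-A₁`
    (Summable (fun l : ℕ => (2 : ℝ) ^ (-(l : ℤ) - 1) * l * Real.logb 2 l) ∧
      Tendsto (fun n : ℕ => Real.logb 2 (2 * Real.exp 1) - DeletionChannel.W 1 n) atTop
        (𝓝 DeletionChannel.A₁)) ∧
    -- the resulting first-order lower bound on the capacity
    (∀ ε > 0, ∀ᶠ p in 𝓝[>] (0 : ℝ),
      DeletionChannel.capacity p ≥ 1 + p * Real.logb 2 p - (DeletionChannel.A₁ + ε) * p) := by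
  refine ⟨fun p hp => DeletionChannel.tendsto_maxInfo_div hp,
    fun p hp n hn => DeletionChannel.lowerBound_le_capacity hp hn, fun n hn => ?_,
    fun n hn => DeletionChannel.isBigO_lowerBound hn,
    ⟨DeletionChannel.summable_mul_logb, DeletionChannel.tendsto_W_one.const_sub _⟩,
    fun ε hε => DeletionChannel.eventually_le_capacity hε⟩
  obtain ⟨t, ht, h⟩ :=
    DeletionChannel.exists_threshold (by omega) (DeletionChannel.lt_runMean_mul_logb hn)
  refine ⟨t, ht, fun hn11 => (h _ (by norm_num)).1 (sub_pos.2 (DeletionChannel.lt_runMean_runGain hn11)),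
    fun p hp => (DeletionChannel.one_sub_Hb_lt_lowerBound_iff (by omega) p).trans (h p hp)⟩
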